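/- Let $N \ge 1$, and let $\{\xi_{i,j}(s) : 1 \le i,j \le N,\ s \ge 1\}$ be an i.i.d. family of real random variables. Given (possibly random) initial positions $X_1(0),\dots,X_N(0) \in \mathbb{R}$, define for $t \ge 0$ $$X_i(t+1) = \max_{1 \le j \le N} \{X_j(t) + \xi_{i,j}(t+1)\}, \qquad 1 \le i \le N .$$ Let $\Delta_N^0 = \{y \in \mathbb{R}^N : 0 = y_1 \ge y_2 \ge \dots \ge y_N\}$. Consider the Markov chain $Y^0$ on $\Delta_N^0$ in which $Y^0(t+1)$ is obtained from $y = Y^0(t)$ by arranging the numbers $\max_{j}\{y_j + \xi_{i,j}(t+1)\}$, $1 \le i \le N$, in non-increasing order and subtracting their maximum from each of them. This chain has a unique invariant probability measure $\nu$ on $\Delta_N^0$, and the following holds. (i) If $\xi \in L^1$, then for all initial positions the limits $$v_N = \lim_{t\to\infty} t^{-1} \max_{1 \le i \le N} X_i(t) = \lim_{t\to\infty} t^{-1} \min_{1 \le i \le N} X_i(t)$$ exist almost surely and are equal to the constant $$v_N = \int_{\Delta_N^0} \mathbb{E} \max_{1 \le i,j \le N} \{y_j + \xi_{i,j}(1)\}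 \, d\nu(y),$$ where the expectation is finite for every $y \in \Delta_N^0$ and is $\nu$-integrable as a function of $y$. (ii) If moreover $\xi \in L^2$ and $\xi$ is not almost surely constant, then there is $\sigma_N^2 \in (0,\infty)$ such that, for all initial positions, $t^{-1/2}\big(\max_{1 \le i \le N} X_i(t) - v_N t\big)$ converges in law as $t \to \infty$ to a centered Gaussian random variable with variance $\sigma_N^2$. -/

import Mathlib

open MeasureTheory ProbabilityTheory Filter Topology
open scoped NNReal

namespace BrunetDerrida

variable {N : ℕ} [NeZero N]

/-- The largest coordinate of `x ∈ ℝ^N`. -/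
noncomputable def maxPos (x : Fin N → ℝ) : ℝ := Finset.univ.sup' Finset.univ_nonempty x

/-- The smallest coordinate of `x ∈ ℝ^N`. -/
noncomputable def minPos (x : Fin N → ℝ) : ℝ := Finset.univ.inf' Finset.univ_nonempty x

/-- `max_{i,j} (y_j + a_{i,j})`. -/
noncomputable def maxJump (a : Fin N → Fin N → ℝ) (y : Fin N → ℝ) : ℝ :=
  Finset.univ.sup' Finset.univ_nonempty (fun p : Fin N × Fin N => y p.2 + a p.1 p.2)

/-- One step of the dynamics with noise matrix `a`: the `i`-th new position is
`max_j (x_j + a_{i,j})`. -/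
noncomputable def maxPlus (a : Fin N → Fin N → ℝ) (x : Fin N → ℝ) : Fin N → ℝ :=
  fun i => Finset.univ.sup' Finset.univ_nonempty (fun j => x j + a i j)

/-- The particle system: `X_i(0)` is given by `X₀` and
`X_i(t+1) = max_j (X_j(t) + ξ_{i,j}(t+1))`. Here `ξ s i j` is the variable `ξ_{i,j}(s)`; only the
times `s ≥ 1` are used. -/
noncomputable def particles {Ω : Type*} (ξ : ℕ → Fin N → Fin N → Ω → ℝ) (X₀ : Fin N → Ω → ℝ) :
    ℕ → Ω → Fin N → ℝ
  | 0, ω => fun i => X₀ i ω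
  | t + 1, ω => maxPlus (fun i j => ξ (t + 1) i j ω) (particles ξ X₀ t ω)

/-- The coordinates of `x` rearranged in non-increasing order. -/
noncomputable def ordered {N : ℕ} (x : Fin N → ℝ) : Fin N → ℝ := fun k => x (Tuple.sort x (Fin.rev k))

/-- The shift `x⁰_i = x_i - max_j x_j`. -/
noncomputable def shift (x : Fin N → ℝ) : Fin N → ℝ := fun i => x i - maxPos x

variable (N) in
/-- The state space `Δ_N^0 = {y ∈ ℝ^N : y_1 ≥ y_2 ≥ ⋯ ≥ y_N, y_1 = 0}` of the ordered process seen
from the leading edge (coordinates are numbered from `0`). -/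
def EdgeSpace : Set (Fin N → ℝ) := {y | Antitone y ∧ y 0 = 0}

lemma antitone_ordered {N : ℕ} (x : Fin N → ℝ) : Antitone (ordered x) := fun _ _ h =>
  Tuple.monotone_sort x (Fin.rev_le_rev.mpr h)

lemma shift_ordered_mem (x : Fin N → ℝ) : shift (ordered x) ∈ EdgeSpace N := by
  refine ⟨fun i j h => sub_le_sub_right (antitone_ordered x h) _, ?_⟩
  have h : maxPos (ordered x) = ordered x 0 :=
    le_antisymm (Finset.sup'_le _ _ fun i _ => antitone_ordered x (Fin.zero_le i))
      (Finset.le_sup' (ordered x) (Finset.mem_univ 0))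
  simp [shift, h]

/-- One step of the ordered process seen from the leading edge, with noise matrix `a`: apply the
dynamics, order the result, and shift the maximum to `0`. -/
noncomputable def edgeStep (a : Fin N → Fin N → ℝ) (y : EdgeSpace N) : EdgeSpace N :=
  ⟨shift (ordered (maxPlus a y)), shift_ordered_mem _⟩

lemma measurable_maxPos : Measurable (maxPos : (Fin N → ℝ) → ℝ) := by
  have h := Finset.measurable_sup' (Finset.univ_nonempty (α := Fin N))
    (f := fun i (x : Fin N → ℝ) => x i) (fun i _ => measurable_pi_apply i)
  convert h using 1
  ext x
  simp [maxPos, Finset.sup'_apply]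

lemma measurable_ordered {N : ℕ} : Measurable (ordered : (Fin N → ℝ) → Fin N → ℝ) := by
  refine measurable_pi_lambda _ fun k => measurable_of_Iic fun c => ?_
  have h : (fun x : Fin N → ℝ => ordered x k) ⁻¹' Set.Iic c =
      ⋃ σ : Equiv.Perm (Fin N), ((⋂ i, ⋂ j, ⋂ _ : i ≤ j, {x | x (σ i) ≤ x (σ j)}) ∩
        {x | x (σ (Fin.rev k)) ≤ c}) := by
    ext x
    simp only [Set.mem_preimage, Set.mem_Iic, Set.mem_iUnion, Set.mem_inter_iff, Set.mem_iInter,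
      Set.mem_ofPred_eq]
    constructor
    · exact fun hx => ⟨Tuple.sort x, fun i j hij => Tuple.monotone_sort x hij, hx⟩
    · rintro ⟨σ, hσ, hc⟩
      have := congrFun (Tuple.unique_monotone (f := x) (σ := σ) (τ := Tuple.sort x)
        (fun i j hij => hσ i j hij) (Tuple.monotone_sort x)) (Fin.rev k)
      simp only [Function.comp_apply] at this
      rwa [ordered, ← this]
  rw [h]
  refine MeasurableSet.iUnion fun σ => MeasurableSet.inter ?_ ?_
  · exact MeasurableSet.iInter fun i => MeasurableSet.iInter fun j => MeasurableSet.iInter fun _ =>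
      measurableSet_le (measurable_pi_apply _) (measurable_pi_apply _)
  · exact measurableSet_le (measurable_pi_apply _) measurable_const

lemma measurable_maxPlus :
    Measurable (fun p : (Fin N → Fin N → ℝ) × (Fin N → ℝ) => maxPlus p.1 p.2) := by
  refine measurable_pi_lambda _ fun i => ?_
  have : (fun p : (Fin N → Fin N → ℝ) × (Fin N → ℝ) => maxPlus p.1 p.2 i) =
      fun p => maxPos (fun j => p.2 j + p.1 i j) := rfl
  rw [this]
  exact measurable_maxPos.comp (by fun_prop)

lemma measurable_edgeStep :
    Measurable (fun p : (Fin N → Fin N → ℝ) × EdgeSpace N => edgeStep p.1 p.2) := by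
  refine Measurable.subtype_mk ?_
  have h1 : Measurable (fun p : (Fin N → Fin N → ℝ) × EdgeSpace N =>
      ordered (maxPlus p.1 (p.2 : Fin N → ℝ))) :=
    measurable_ordered.comp (measurable_maxPlus.comp
      (measurable_fst.prodMk (measurable_subtype_coe.comp measurable_snd)))
  refine measurable_pi_lambda _ fun i => ?_
  exact ((measurable_pi_apply i).comp h1).sub (measurable_maxPos.comp h1)

variable (N) in
/-- The law of an `N × N` matrix with i.i.d. entries of law `ρ`. -/
noncomputable def noiseLaw (ρ : Measure ℝ) : Measure (Fin N → Fin N → ℝ) :=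
  Measure.pi fun _ => Measure.pi fun _ => ρ

variable (N) in
/-- The transition kernel of the Markov chain `Y⁰` (the ordered process seen from the leading
edge) when the noise has law `ρ`: from `y` the chain moves to `edgeStep a y`, where `a` has i.i.d.
entries of law `ρ`. -/
noncomputable def edgeKernel (ρ : Measure ℝ) [IsProbabilityMeasure ρ] :
    Kernel (EdgeSpace N) (EdgeSpace N) where
  toFun y := (noiseLaw N ρ).map (fun a => edgeStep a y)
  measurable' := by
    have : IsProbabilityMeasure (noiseLaw N ρ) := by unfold noiseLaw; infer_instance
    refine Measure.measurable_of_measurable_coe _ fun s hs => ?_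
    have h : ∀ y : EdgeSpace N, ((noiseLaw N ρ).map (fun a => edgeStep a y)) s =
        noiseLaw N ρ ((fun a => (a, y)) ⁻¹'
          ((fun p : (Fin N → Fin N → ℝ) × EdgeSpace N => edgeStep p.1 p.2) ⁻¹' s)) := fun y =>
      Measure.map_apply (measurable_edgeStep.comp (measurable_id.prodMk measurable_const)) hs
    simp_rw [h]
    exact measurable_measure_prodMk_right (measurable_edgeStep hs)

variable (N) in
/-- `ν` is an invariant probability measure of the ordered process seen from the leading edge. -/
def IsInvariantLaw (ρ : Measure ℝ) [IsProbabilityMeasure ρ] (ν : Measure (EdgeSpace N)) : Prop :=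
  IsProbabilityMeasure ν ∧ Kernel.Invariant (edgeKernel N ρ) ν

end BrunetDerrida

/-! A step is monotone, commutes with adding a constant to all positions, and leaves every particle
within the size of the new noise of the previous maximum. Hence flattening the profile to its
maximum at time `n` changes the later front by at most `2 * ‖a n‖`: up to this junction error, which
has a sign, the front after `n + m` steps is the front after `n` steps plus a fresh independent
front of `m` steps (`front_add_le`, `le_front_add`). An arbitrary start moves the maximum by at most
the norm of the start, so it suffices to study `front`.

Law of large numbers: the means are almost additive, hence equal to `v * n` up to a bounded error
(`exists_speed`). Cut time into blocks of length `l`; the strong law applies to the i.i.d. block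
fronts, and the junctions cost `O(1 / l)` per unit of time (`ae_tendsto_front_div`).

Central limit theorem: the accumulated junction error over `k` blocks has standard deviation `O(√k)`
uniformly in `l` (`stdDev_defect_le`), because it splits into two independent halves and one further
junction. On the scale `√(k * l)` this is `O(1 / √l)`, so the classical theorem for blocks survives
the limit `l → ∞` (`tendstoInDistribution_front`); the same bound makes the rescaled standard
deviation converge. The limit is positive because the front is correlated with the noise of every
single step (`variance_front_ge`).

Invariant law: with positive probability all particles can descend from the leader, and then the
next state forgets the current one. This minorization gives existence and uniqueness. In the
stationary regime the mean front grows by exactly the integral in the formula at each step, and it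
stays within a bounded distance of the mean front from the origin, so that integral is `v`
(`speed_eq_integral`). -/

namespace BrunetDerrida

/-! ### Pathwise estimates: monotonicity, restarting, and junction errors. -/

section Deterministic

variable {N : ℕ} [NeZero N]

lemma le_maxPos (x : Fin N → ℝ) (i : Fin N) : x i ≤ maxPos x :=
  Finset.le_sup' x (Finset.mem_univ i)

lemma maxPos_le {x : Fin N → ℝ} {c : ℝ} (h : ∀ i, x i ≤ c) : maxPos x ≤ c :=
  Finset.sup'_le _ _ fun i _ => h i

lemma minPos_le (x : Fin N → ℝ) (i : Fin N) : minPos x ≤ x i :=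
  Finset.inf'_le x (Finset.mem_univ i)

lemma le_minPos {x : Fin N → ℝ} {c : ℝ} (h : ∀ i, c ≤ x i) : c ≤ minPos x :=
  Finset.le_inf' _ _ fun i _ => h i

lemma exists_eq_maxPos (x : Fin N → ℝ) : ∃ i, x i = maxPos x := by
  obtain ⟨i, -, hi⟩ := Finset.exists_mem_eq_sup' Finset.univ_nonempty x
  exact ⟨i, hi.symm⟩

lemma minPos_le_maxPos (x : Fin N → ℝ) : minPos x ≤ maxPos x :=
  (minPos_le x 0).trans (le_maxPos x 0)

lemma maxPos_zero : maxPos (0 : Fin N → ℝ) = 0 := by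
  simp [maxPos]

lemma maxPos_mono {x y : Fin N → ℝ} (h : ∀ i, x i ≤ y i) : maxPos x ≤ maxPos y :=
  maxPos_le fun i => (h i).trans (le_maxPos y i)

lemma maxPos_add_const (x : Fin N → ℝ) (c : ℝ) : maxPos (fun i => x i + c) = maxPos x + c := by
  apply le_antisymm
  · exact maxPos_le fun i => by linarith [le_maxPos x i]
  · obtain ⟨i, hi⟩ := exists_eq_maxPos x
    rw [← hi]
    exact le_maxPos (fun i => x i + c) i

lemma abs_maxPos_le (x : Fin N → ℝ) : |maxPos x| ≤ ‖x‖ := by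
  obtain ⟨i, hi⟩ := exists_eq_maxPos x
  rw [← hi]
  exact norm_le_pi_norm x i

lemma maxPlus_apply (a : Fin N → Fin N → ℝ) (x : Fin N → ℝ) (i : Fin N) :
    maxPlus a x i = maxPos fun j => x j + a i j := rfl

omit [NeZero N] in
lemma abs_entry_le (a : Fin N → Fin N → ℝ) (i j : Fin N) : |a i j| ≤ ‖a‖ :=
  (norm_le_pi_norm (a i) j).trans (norm_le_pi_norm a i)

lemma le_maxPlus (a : Fin N → Fin N → ℝ) (x : Fin N → ℝ) (i j : Fin N) :
    x j + a i j ≤ maxPlus a x i :=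
  le_maxPos (fun j => x j + a i j) j

lemma maxPlus_mono {a b : Fin N → Fin N → ℝ} {x y : Fin N → ℝ} (hab : ∀ i j, a i j ≤ b i j)
    (h : ∀ i, x i ≤ y i) (i : Fin N) : maxPlus a x i ≤ maxPlus b y i :=
  maxPos_mono fun j => add_le_add (h j) (hab i j)

lemma maxPlus_add_const (a : Fin N → Fin N → ℝ) (x : Fin N → ℝ) (c : ℝ) :
    maxPlus a (fun j => x j + c) = fun i => maxPlus a x i + c := by
  ext i
  rw [maxPlus_apply, maxPlus_apply, ← maxPos_add_const]
  congr 1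
  ext j
  ring

lemma maxPlus_const (c : ℝ) (x : Fin N → ℝ) :
    maxPlus (fun _ _ => c) x = fun _ => maxPos x + c := by
  ext i
  rw [maxPlus_apply, maxPos_add_const]

lemma maxPlus_le (a : Fin N → Fin N → ℝ) (x : Fin N → ℝ) (i : Fin N) :
    maxPlus a x i ≤ maxPos x + ‖a‖ :=
  maxPos_le fun j => add_le_add (le_maxPos x j) ((le_abs_self _).trans (abs_entry_le a i j))

lemma sub_norm_le_maxPlus (a : Fin N → Fin N → ℝ) (x : Fin N → ℝ) (i : Fin N) :
    maxPos x - ‖a‖ ≤ maxPlus a x i := by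
  obtain ⟨j, hj⟩ := exists_eq_maxPos x
  have := le_maxPlus a x i j
  have := neg_le_of_abs_le (abs_entry_le a i j)
  linarith

lemma maxPos_maxPlus_le (a : Fin N → Fin N → ℝ) (x : Fin N → ℝ) :
    maxPos (maxPlus a x) ≤ maxPos x + ‖a‖ := maxPos_le (maxPlus_le a x)

lemma abs_maxPos_maxPlus_sub_le (a : Fin N → Fin N → ℝ) (x : Fin N → ℝ) :
    |maxPos (maxPlus a x) - maxPos x| ≤ ‖a‖ := by
  rw [abs_le]
  have := maxPos_maxPlus_le a x
  have := (sub_norm_le_maxPlus a x 0).trans (le_maxPos _ 0)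
  constructor <;> linarith

/-- The positions after `n` steps with noises `a 0, …, a (n - 1)`, started from `x`. -/
noncomputable def flow (a : ℕ → Fin N → Fin N → ℝ) (x : Fin N → ℝ) : ℕ → Fin N → ℝ
  | 0 => x
  | n + 1 => maxPlus (a n) (flow a x n)

/-- The leading position after `n` steps, started from the origin. -/
noncomputable def front (a : ℕ → Fin N → Fin N → ℝ) (n : ℕ) : ℝ := maxPos (flow a 0 n)

lemma particles_eq_flow {Ω : Type*} (ξ : ℕ → Fin N → Fin N → Ω → ℝ) (X₀ : Fin N → Ω → ℝ) (t : ℕ)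
    (ω : Ω) : particles ξ X₀ t ω =
      flow (fun s i j => ξ (s + 1) i j ω) (fun i => X₀ i ω) t := by
  induction t with
  | zero => rfl
  | succ t ih => simp only [particles, flow, ih]

lemma flow_congr {a b : ℕ → Fin N → Fin N → ℝ} {n : ℕ} (h : ∀ k < n, a k = b k)
    (x : Fin N → ℝ) : flow a x n = flow b x n := by
  induction n with
  | zero => rfl
  | succ n ih =>
    rw [flow, flow, ih fun k hk => h k (by omega), h n (by omega)]

lemma front_congr {a b : ℕ → Fin N → Fin N → ℝ} {n : ℕ} (h : ∀ k < n, a k = b k) :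
    front a n = front b n := by rw [front, front, flow_congr h]

lemma flow_add (a : ℕ → Fin N → Fin N → ℝ) (x : Fin N → ℝ) (n m : ℕ) :
    flow a x (n + m) = flow (fun k => a (n + k)) (flow a x n) m := by
  induction m with
  | zero => rfl
  | succ m ih => rw [← add_assoc, flow, flow, ih]

lemma flow_mono {a b : ℕ → Fin N → Fin N → ℝ} (hab : ∀ k i j, a k i j ≤ b k i j)
    {x y : Fin N → ℝ} (h : ∀ i, x i ≤ y i) (n : ℕ) (i : Fin N) : flow a x n i ≤ flow b y n i := by
  induction n generalizing i with
  | zero => exact h i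
  | succ n ih => exact maxPlus_mono (hab n) ih i

lemma flow_add_const (a : ℕ → Fin N → Fin N → ℝ) (x : Fin N → ℝ) (c : ℝ) (n : ℕ) :
    flow a (fun i => x i + c) n = fun i => flow a x n i + c := by
  induction n with
  | zero => rfl
  | succ n ih => rw [flow, ih, maxPlus_add_const]; rfl

lemma maxPos_flow_const (a : ℕ → Fin N → Fin N → ℝ) (c : ℝ) (n : ℕ) :
    maxPos (flow a (fun _ => c) n) = front a n + c := by
  have := flow_add_const a 0 c n
  simp only [Pi.zero_apply, zero_add] at this
  rw [this, maxPos_add_const, front]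

lemma front_zero (a : ℕ → Fin N → Fin N → ℝ) : front a 0 = 0 := maxPos_zero

lemma front_mono {a b : ℕ → Fin N → Fin N → ℝ} (hab : ∀ k i j, a k i j ≤ b k i j) (n : ℕ) :
    front a n ≤ front b n := maxPos_mono (flow_mono hab (fun _ => le_rfl) n)

lemma maxPos_flow_le (a : ℕ → Fin N → Fin N → ℝ) (x : Fin N → ℝ) (n : ℕ) :
    maxPos (flow a x n) ≤ front a n + maxPos x := by
  rw [← maxPos_flow_const]
  exact maxPos_mono (flow_mono (fun _ _ _ => le_rfl) (le_maxPos x) n)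

lemma le_maxPos_flow (a : ℕ → Fin N → Fin N → ℝ) {x : Fin N → ℝ} {c : ℝ} (hc : ∀ i, c ≤ x i)
    (n : ℕ) : front a n + c ≤ maxPos (flow a x n) := by
  rw [← maxPos_flow_const]
  exact maxPos_mono (flow_mono (fun _ _ _ => le_rfl) hc n)

lemma abs_maxPos_flow_sub_front_le (a : ℕ → Fin N → Fin N → ℝ) (x : Fin N → ℝ) (n : ℕ) :
    |maxPos (flow a x n) - front a n| ≤ ‖x‖ := by
  have h1 := maxPos_flow_le a x n
  have h2 := (le_abs_self _).trans (abs_maxPos_le x)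
  have h3 := le_maxPos_flow a (x := x) (c := -‖x‖)
    (fun i => neg_le_of_abs_le (norm_le_pi_norm x i)) n
  rw [abs_le]
  constructor <;> linarith

/-- Every particle may descend from the previous leader, so one step confines the cloud to a window
governed by the last noise alone, whatever the start. This transfers the speed of the maximum to the
minimum. -/
lemma maxPos_sub_minPos_flow_le (a : ℕ → Fin N → Fin N → ℝ) (x : Fin N → ℝ) (n : ℕ) :
    maxPos (flow a x (n + 1)) - 2 * ‖a n‖ ≤ minPos (flow a x (n + 1)) := by
  refine le_minPos fun i => ?_
  have h1 := maxPos_maxPlus_le (a n) (flow a x n)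
  have h2 := sub_norm_le_maxPlus (a n) (flow a x n) i
  simp only [flow]
  linarith

lemma front_add_le (a : ℕ → Fin N → Fin N → ℝ) (n m : ℕ) :
    front a (n + m) ≤ front a n + front (fun k => a (n + k)) m := by
  rw [front, flow_add, add_comm]
  exact maxPos_flow_le _ _ _

/-- If the largest coordinate of `x` is `c`, then starting from `x` instead of `(c, …, c)` loses at
most twice the size of the first noise. -/
lemma le_maxPos_flow_maxPos (a : ℕ → Fin N → Fin N → ℝ) (x : Fin N → ℝ) (n : ℕ) :
    front a n + maxPos x - 2 * ‖a 0‖ ≤ maxPos (flow a x n) := by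
  cases n with
  | zero =>
    rw [front_zero, flow]
    linarith [norm_nonneg (a 0)]
  | succ n =>
    -- Split off the first step: after it, all particles started from `x` are above `maxPos x - ‖a
    -- 0‖` and all those started from the origin are below `‖a 0‖`. Monotonicity preserves the
    -- comparison afterwards.
    rw [front, add_comm n 1, flow_add, flow_add]
    have h1 := maxPos_flow_le (fun k => a (1 + k)) (flow a 0 1) n
    have h2 := le_maxPos_flow (fun k => a (1 + k)) (x := flow a x 1)
      (sub_norm_le_maxPlus (a 0) x) n
    have h3 := maxPos_maxPlus_le (a 0) 0
    rw [maxPos_zero] at h3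
    have h4 : maxPos (flow a 0 1) ≤ 0 + ‖a 0‖ := h3
    linarith

lemma le_front_add (a : ℕ → Fin N → Fin N → ℝ) (n m : ℕ) :
    front a n + front (fun k => a (n + k)) m - 2 * ‖a n‖ ≤ front a (n + m) := by
  have h := le_maxPos_flow_maxPos (fun k => a (n + k)) (flow a 0 n) m
  rw [← flow_add, ← front, ← front, add_zero] at h
  linarith

lemma abs_front_add_sub_le (a : ℕ → Fin N → Fin N → ℝ) (n m : ℕ) :
    |front a (n + m) - front a n| ≤ ∑ k ∈ Finset.range m, ‖a (n + k)‖ := by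
  induction m with
  | zero => simp
  | succ m ih =>
    rw [Finset.sum_range_succ]
    have := abs_maxPos_maxPlus_sub_le (a (n + m)) (flow a 0 (n + m))
    calc |front a (n + m + 1) - front a n|
        ≤ |front a (n + m + 1) - front a (n + m)| + |front a (n + m) - front a n| :=
          abs_sub_le _ _ _
      _ ≤ ‖a (n + m)‖ + _ := add_le_add this ih
      _ = _ := add_comm _ _

lemma abs_front_le (a : ℕ → Fin N → Fin N → ℝ) (n : ℕ) :
    |front a n| ≤ ∑ k ∈ Finset.range n, ‖a k‖ := by
  simpa [front_zero] using abs_front_add_sub_le a 0 n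

/-- All paths use exactly one entry of the noise at time `j`. -/
lemma front_update_const (a : ℕ → Fin N → Fin N → ℝ) {j n : ℕ} (hj : j < n) (c : ℝ) :
    front (Function.update a j fun _ _ => c) n =
      front (Function.update a j fun _ _ => 0) n + c := by
  obtain ⟨m, rfl⟩ := Nat.exists_eq_add_of_le hj
  -- With constant noise at time `j` the front factors into the past, the constant and a fresh front
  -- for the future; only the middle term depends on `c`.
  have key (c : ℝ) : front (Function.update a j fun _ _ => c) (j + 1 + m) =
      front (fun k => a (j + 1 + k)) m + (front a j + c) := by
    have h1 : flow (Function.update a j fun _ _ => c) 0 j = flow a 0 j :=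
      flow_congr (fun k hk => Function.update_of_ne hk.ne _ _) _
    have h2 : (fun k => Function.update a j (fun _ _ => c) (j + 1 + k)) =
        fun k => a (j + 1 + k) :=
      funext fun k => Function.update_of_ne (by omega) _ _
    rw [front, flow_add, flow, h1, h2, Function.update_self, maxPlus_const, maxPos_flow_const,
      ← front]
  rw [Nat.succ_eq_add_one, key, key]
  ring

lemma measurable_flow (x : Fin N → ℝ) (n : ℕ) :
    Measurable (fun a : ℕ → Fin N → Fin N → ℝ => flow a x n) := by
  induction n with
  | zero => exact measurable_const
  | succ n ih => exact measurable_maxPlus.comp ((measurable_pi_apply n).prodMk ih)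

lemma measurable_front (n : ℕ) :
    Measurable (fun a : ℕ → Fin N → Fin N → ℝ => front a n) :=
  measurable_maxPos.comp (measurable_flow 0 n)

/-- The difference between the leading position after `k` blocks of `l` steps and the sum of the
leading positions over the blocks, each started afresh from the origin. -/
noncomputable def defect (l : ℕ) (a : ℕ → Fin N → Fin N → ℝ) (k : ℕ) : ℝ :=
  front a (k * l) - ∑ j ∈ Finset.range k, front (fun i => a (j * l + i)) l

lemma measurable_defect (l k : ℕ) :
    Measurable (fun a : ℕ → Fin N → Fin N → ℝ => defect l a k) := by
  refine (measurable_front _).sub (Finset.measurable_fun_sum _ fun j _ => ?_)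
  exact (measurable_front l).comp (measurable_pi_lambda _ fun i => measurable_pi_apply _)

lemma defect_congr {a b : ℕ → Fin N → Fin N → ℝ} {l k : ℕ} (h : ∀ i < k * l, a i = b i) :
    defect l a k = defect l b k := by
  rw [defect, defect, front_congr h]
  congr 1
  refine Finset.sum_congr rfl fun j hj => front_congr fun i hi => h _ ?_
  have : j + 1 ≤ k := Finset.mem_range.1 hj
  calc j * l + i < (j + 1) * l := by rw [add_mul]; omega
    _ ≤ k * l := Nat.mul_le_mul_right l this

lemma defect_one (l : ℕ) (a : ℕ → Fin N → Fin N → ℝ) : defect l a 1 = 0 := by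
  simp [defect]

/-- Merging two groups of blocks creates a single new junction, the last bracket. The recursion
behind `stdDev_defect_le` rests on this. -/
lemma defect_add (l : ℕ) (a : ℕ → Fin N → Fin N → ℝ) (p q : ℕ) :
    defect l a (p + q) = defect l a p + defect l (fun i => a (p * l + i)) q +
      (front a (p * l + q * l) - front a (p * l) - front (fun i => a (p * l + i)) (q * l)) := by
  simp only [defect, Finset.sum_range_add, add_mul, ← add_assoc]
  ring

/-- Each junction error is nonpositive and at least minus twice the first noise of the block it
opens. Such a bound of order `k` is enough for the law of large numbers but not for fluctuations. -/
lemma defect_nonpos_and_ge (l : ℕ) (a : ℕ → Fin N → Fin N → ℝ) (k : ℕ) :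
    defect l a k ≤ 0 ∧ -∑ j ∈ Finset.range k, 2 * ‖a (j * l)‖ ≤ defect l a k := by
  induction k with
  | zero => simp [defect, front_zero]
  | succ k ih =>
    rw [defect_add, defect_one, Finset.sum_range_succ, one_mul]
    have h1 := front_add_le a (k * l) l
    have h2 := le_front_add a (k * l) l
    constructor <;> linarith [ih.1, ih.2]

end Deterministic

/-! ### Independence and shift invariance for functionals of an i.i.d. sequence. -/

section IndependentSequences

variable {Ω : Type*} [MeasurableSpace Ω] {P : Measure Ω} {S : Type*} [MeasurableSpace S]

/-- The rows of an independent array are independent. -/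
lemma iIndepFun_curry {ι κ : Type*} {X : ι × κ → Ω → S}
    (hX : ∀ p, Measurable (X p)) (h : iIndepFun X P) :
    iIndepFun (fun i ω j => X (i, j) ω) P := by
  have := h.isProbabilityMeasure
  have hprob : ∀ p, IsProbabilityMeasure (P.map (X p)) :=
    fun p => Measure.isProbabilityMeasure_map (hX p).aemeasurable
  have hrow (i : ι) : P.map (fun ω j => X (i, j) ω) =
      Measure.infinitePi fun j => P.map (X (i, j)) :=
    (h.precomp (g := fun j => (i, j)) (fun _ _ h => (Prod.mk.inj h).2)).map_fun_eq_infinitePi_map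
      fun j => hX (i, j)
  rw [iIndepFun_iff_map_fun_eq_infinitePi_map
    (fun i => measurable_pi_lambda _ fun j => hX (i, j))]
  simp_rw [hrow]
  -- Independence is read off from joint laws: currying turns the product over pairs into a product
  -- over rows of products.
  rw [← Measure.infinitePi_map_curry (fun i j => P.map (X (i, j))),
    ← h.map_fun_eq_infinitePi_map hX,
    Measure.map_map (MeasurableEquiv.measurable _) (measurable_pi_lambda _ hX)]
  rfl

/-- `f` depends on the first `n` terms of a sequence only. -/
def DependsOnPrefix {β : Type*} (f : (ℕ → S) → β) (n : ℕ) : Prop :=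
  ∀ a b : ℕ → S, (∀ k < n, a k = b k) → f a = f b

variable {A : ℕ → Ω → S}

lemma identDistrib_shift (hA : ∀ k, Measurable (A k)) (hind : iIndepFun A P)
    (hid : ∀ k, IdentDistrib (A k) (A 0) P P) (s : ℕ) :
    IdentDistrib (fun ω k => A (s + k) ω) (fun ω k => A k ω) P P where
  aemeasurable_fst := (measurable_pi_lambda _ fun k => hA (s + k)).aemeasurable
  aemeasurable_snd := (measurable_pi_lambda _ hA).aemeasurable
  map_eq := by
    rw [hind.map_fun_eq_infinitePi_map hA,
      (hind.precomp (add_right_injective s)).map_fun_eq_infinitePi_map fun k => hA (s + k)]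
    simp_rw [(hid _).map_eq]

/-- Both functionals are required to depend on finitely many terms, so that independence over
disjoint finite index sets suffices. -/
lemma indepFun_prefix_suffix [Inhabited S] {β γ : Type*} [MeasurableSpace β] [MeasurableSpace γ]
    (hA : ∀ k, Measurable (A k)) (hind : iIndepFun A P)
    {f : (ℕ → S) → β} {g : (ℕ → S) → γ} (hf : Measurable f) (hg : Measurable g) {n m : ℕ}
    (hfn : DependsOnPrefix f n) (hgm : DependsOnPrefix g m) :
    IndepFun (fun ω => f fun k => A k ω) (fun ω => g fun k => A (n + k) ω) P := by
  classical
  have h := hind.indepFun_finset (Finset.range n) (Finset.Ico n (n + m))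
    (by
      rw [Finset.disjoint_left]
      intro k hk hk'
      simp only [Finset.mem_range, Finset.mem_Ico] at hk hk'
      omega) hA
  -- Finite tuples are padded to sequences with a default value, which the functionals never read.
  let u (b : Finset.range n → S) (k : ℕ) : S :=
    if h : k ∈ Finset.range n then b ⟨k, h⟩ else default
  let w (b : Finset.Ico n (n + m) → S) (k : ℕ) : S :=
    if h : n + k ∈ Finset.Ico n (n + m) then b ⟨n + k, h⟩ else default
  have hu : Measurable u := measurable_pi_lambda _ fun k => by
    by_cases h : k ∈ Finset.range n
    · simp only [u, h, dite_true]; exact measurable_pi_apply _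
    · simp only [u, h, dite_false]; exact measurable_const
  have hw : Measurable w := measurable_pi_lambda _ fun k => by
    by_cases h : n + k ∈ Finset.Ico n (n + m)
    · simp only [w, h, dite_true]; exact measurable_pi_apply _
    · simp only [w, h, dite_false]; exact measurable_const
  convert h.comp (hf.comp hu) (hg.comp hw) using 1
  · ext ω
    exact hfn _ _ fun k hk => by simp [u, hk]
  · ext ω
    exact hgm _ _ fun k hk => by simp [w, hk]

lemma iIndepFun_blocks [Inhabited S] (hA : ∀ k, Measurable (A k)) (hind : iIndepFun A P)
    {f : (ℕ → S) → ℝ} (hf : Measurable f) {l : ℕ} (hfl : DependsOnPrefix f l) :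
    iIndepFun (fun (j : ℕ) ω => f fun i => A (j * l + i) ω) P := by
  classical
  -- Euclidean division by `l` lays the array of blocks injectively along the time axis.
  have hinj : Function.Injective (fun p : ℕ × Fin l => p.1 * l + p.2) := by
    rintro ⟨j, r⟩ ⟨j', r'⟩ h
    simp only at h
    have hl : 0 < l := r.pos
    have h1 : j = j' := by
      have := congrArg (· / l) h
      simpa [Nat.mul_comm _ l, Nat.mul_add_div hl, Nat.div_eq_of_lt r.2,
        Nat.div_eq_of_lt r'.2] using this
    subst h1
    have : r = r' := Fin.ext (by omega)
    rw [this]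
  let u (b : Fin l → S) (k : ℕ) : S := if h : k < l then b ⟨k, h⟩ else default
  have hu : Measurable u := measurable_pi_lambda _ fun k => by
    by_cases h : k < l
    · simp only [u, h, dite_true]; exact measurable_pi_apply _
    · simp only [u, h, dite_false]; exact measurable_const
  have h := (iIndepFun_curry (fun p => hA _) (hind.precomp hinj)).comp
    (fun _ => f ∘ u) (fun _ => hf.comp hu)
  convert h using 1
  ext j ω
  exact hfl _ _ fun k hk => by simp [u, hk]

end IndependentSequences

/-! ### Standard deviations and characteristic functions. -/

section Moments

variable {Ω : Type*} [MeasurableSpace Ω] {P : Measure Ω} [IsProbabilityMeasure P]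

lemma covariance_sq_le {X Y : Ω → ℝ} (hX : MemLp X 2 P) (hY : MemLp Y 2 P) :
    cov[X, Y; P] ^ 2 ≤ Var[X; P] * Var[Y; P] := by
  -- The variance of `X + t * Y` is a nonnegative quadratic in `t`; its discriminant gives
  -- Cauchy–Schwarz.
  have h (t : ℝ) : 0 ≤ Var[Y; P] * (t * t) + (2 * cov[X, Y; P]) * t + Var[X; P] := by
    have h1 := variance_nonneg (X + fun ω => t * Y ω) P
    rw [variance_add hX (hY.const_mul t), covariance_const_mul_right, variance_const_mul] at h1
    linarith
  have := discrim_le_zero h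
  rw [discrim] at this
  linarith

/-- The standard deviation. -/
noncomputable def stdDev (X : Ω → ℝ) (P : Measure Ω) : ℝ := √Var[X; P]

omit [IsProbabilityMeasure P] in
lemma stdDev_nonneg (X : Ω → ℝ) : 0 ≤ stdDev X P := Real.sqrt_nonneg _

omit [IsProbabilityMeasure P] in
lemma stdDev_sq (X : Ω → ℝ) : stdDev X P ^ 2 = Var[X; P] := Real.sq_sqrt (variance_nonneg _ _)

lemma stdDev_add_le {X Y : Ω → ℝ} (hX : MemLp X 2 P) (hY : MemLp Y 2 P) :
    stdDev (X + Y) P ≤ stdDev X P + stdDev Y P := by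
  have hn := add_nonneg (stdDev_nonneg X (P := P)) (stdDev_nonneg Y (P := P))
  refine Real.sqrt_le_iff.2 ⟨hn, ?_⟩
  have h1 : cov[X, Y; P] ≤ stdDev X P * stdDev Y P := by
    refine abs_le_of_sq_le_sq' ?_ (mul_nonneg (stdDev_nonneg _) (stdDev_nonneg _)) |>.2
    rw [mul_pow, stdDev_sq, stdDev_sq]
    exact covariance_sq_le hX hY
  rw [variance_add hX hY, ← stdDev_sq X, ← stdDev_sq Y]
  linarith

omit [IsProbabilityMeasure P] in
lemma stdDev_neg (X : Ω → ℝ) : stdDev (-X) P = stdDev X P := by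
  rw [stdDev, variance_neg, stdDev]

lemma abs_stdDev_sub_le {X Y : Ω → ℝ} (hX : MemLp X 2 P) (hY : MemLp Y 2 P) :
    |stdDev X P - stdDev Y P| ≤ stdDev (X - Y) P := by
  have h1 := stdDev_add_le (hX.sub hY) hY
  have h2 := stdDev_add_le (hX.sub hY).neg hX
  rw [sub_add_cancel] at h1
  rw [neg_sub, sub_add_cancel, ← neg_sub, stdDev_neg] at h2
  rw [abs_le]
  constructor <;> linarith

lemma stdDev_le_of_abs_le {X Y : Ω → ℝ} (hX : AEStronglyMeasurable X P) (hY : MemLp Y 2 P)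
    (h : ∀ ω, |X ω| ≤ Y ω) : stdDev X P ≤ √(∫ ω, Y ω ^ 2 ∂P) := by
  refine Real.sqrt_le_sqrt ((variance_le_expectation_sq hX).trans ?_)
  have hX2 : MemLp X 2 P := hY.mono' hX (.of_forall h)
  refine integral_mono hX2.integrable_sq hY.integrable_sq fun ω => ?_
  exact sq_le_sq' (neg_le_of_abs_le (h ω)) ((le_abs_self _).trans (h ω))

/-- `E|X - E X|` is at most the standard deviation. -/
lemma integral_abs_sub_integral_le {X : Ω → ℝ} (hX : MemLp X 2 P) :
    ∫ ω, |X ω - P[X]| ∂P ≤ stdDev X P := by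
  have h : MemLp (fun ω => |X ω - P[X]|) 2 P := (hX.sub (memLp_const _)).abs
  refine Real.le_sqrt_of_sq_le ?_
  -- Nonnegativity of the variance of `|X - E X|` says that its squared mean is at most its second
  -- moment, the variance of `X`.
  have h1 := variance_eq_sub h
  have h2 := variance_nonneg (fun ω => |X ω - P[X]|) P
  rw [variance_eq_integral hX.aemeasurable]
  have h3 : P[(fun ω => |X ω - P[X]|) ^ 2] = ∫ ω, (X ω - P[X]) ^ 2 ∂P := by
    simp [sq_abs]
  rw [← h3]
  linarith

omit [IsProbabilityMeasure P] in
-- The map `x ↦ exp (iθx)` is `|θ|`-Lipschitz, so approximation in `L¹` suffices to compare laws in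
-- the central limit theorem.
lemma norm_charFun_map_sub_le [IsFiniteMeasure P] {X Y : Ω → ℝ} (hX : Integrable X P)
    (hY : Integrable Y P) (θ : ℝ) :
    ‖charFun (P.map X) θ - charFun (P.map Y) θ‖ ≤ |θ| * ∫ ω, |X ω - Y ω| ∂P := by
  have hm (Z : Ω → ℝ) (hZ : AEStronglyMeasurable Z P) :
      AEStronglyMeasurable (fun ω => Complex.exp (θ * Z ω * Complex.I)) P :=
    (Complex.continuous_exp.comp (by fun_prop : Continuous fun x : ℝ =>
      (θ : ℂ) * x * Complex.I)).comp_aestronglyMeasurable hZ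
  have hi (Z : Ω → ℝ) (hZ : AEStronglyMeasurable Z P) :
      Integrable (fun ω => Complex.exp (θ * Z ω * Complex.I)) P := by
    refine (integrable_const (1 : ℝ)).mono' (hm Z hZ) (.of_forall fun ω => ?_)
    rw [← Complex.ofReal_mul, Complex.norm_exp_ofReal_mul_I]
  have hc (Z : Ω → ℝ) (hZ : AEStronglyMeasurable Z P) :
      charFun (P.map Z) θ = ∫ ω, Complex.exp (θ * Z ω * Complex.I) ∂P := by
    rw [charFun_apply_real, integral_map hZ.aemeasurable]
    exact (by fun_prop : Continuous fun x : ℝ =>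
      Complex.exp ((θ : ℂ) * x * Complex.I)).aestronglyMeasurable
  rw [hc X hX.1, hc Y hY.1, ← integral_sub (hi X hX.1) (hi Y hY.1), ← integral_const_mul]
  refine norm_integral_le_of_norm_le ((hX.sub hY).abs.const_mul _) (.of_forall fun ω => ?_)
  have e : Complex.exp (θ * X ω * Complex.I) - Complex.exp (θ * Y ω * Complex.I) =
      Complex.exp (((θ * Y ω : ℝ) : ℂ) * Complex.I) *
        (Complex.exp (Complex.I * ((θ * (X ω - Y ω) : ℝ) : ℂ)) - 1) := by
    rw [mul_sub, ← Complex.exp_add, mul_one]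
    push_cast
    ring_nf
  rw [e, norm_mul, Complex.norm_exp_ofReal_mul_I, one_mul]
  refine (Real.norm_exp_I_mul_ofReal_sub_one_le).trans ?_
  rw [Real.norm_eq_abs, abs_mul]

end Moments

/-! ### Almost additive sequences and the numerical inequality of the halving argument. -/

section RealSequences

/-- Both `g m` and `g n` are close to `g (n * m)`, so `g` is Cauchy. It serves the speed with `r n =
n` and the diffusivity with `r n = √n`. -/
lemma exists_limit_of_abs_mul_sub_le {g r : ℕ → ℝ} {K : ℝ} (hr : Tendsto r atTop atTop)
    (h : ∀ k l, 1 ≤ k → 1 ≤ l → |g (k * l) - g l| ≤ K / r l) :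
    ∃ σ, Tendsto g atTop (𝓝 σ) ∧ ∀ l, 1 ≤ l → |σ - g l| ≤ K / r l := by
  have hsmall : Tendsto (fun n => K / r n) atTop (𝓝 0) := hr.const_div_atTop K
  have hc : CauchySeq g := by
    refine Metric.cauchySeq_iff.2 fun ε hε => ?_
    obtain ⟨n₀, hn₀⟩ := eventually_atTop.1
      ((hsmall.eventually (gt_mem_nhds (half_pos hε))).and (eventually_ge_atTop 1))
    refine ⟨n₀, fun m hm n hn => ?_⟩
    have h1 := h n m (hn₀ n hn).2 (hn₀ m hm).2
    have h2 := h m n (hn₀ m hm).2 (hn₀ n hn).2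
    rw [mul_comm m n] at h2
    rw [Real.dist_eq]
    have := abs_sub_le (g m) (g (n * m)) (g n)
    rw [abs_sub_comm (g m) (g (n * m))] at this
    linarith [(hn₀ n hn).1, (hn₀ m hm).1]
  obtain ⟨σ, hσ⟩ := cauchySeq_tendsto_of_complete hc
  refine ⟨σ, hσ, fun l hl => ?_⟩
  have h1 : Tendsto (fun k => |g (k * l) - g l|) atTop (𝓝 |σ - g l|) :=
    ((hσ.comp (tendsto_id.atTop_mul_const' (by omega))).sub_const _).abs
  exact le_of_tendsto h1 ((eventually_ge_atTop 1).mono fun k hk => h k l hk hl)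

lemma exists_rate_of_almost_additive {m : ℕ → ℝ} {C : ℝ} (h0 : m 0 = 0)
    (hle : ∀ n k, m (n + k) ≤ m n + m k) (hge : ∀ n k, m n + m k - C ≤ m (n + k)) :
    ∃ v : ℝ, ∀ n : ℕ, |m n - v * n| ≤ C := by
  have hC : 0 ≤ C := by
    have := hge 0 0
    simp only [h0, add_zero] at this
    linarith
  have hk (l k : ℕ) : m (k * l) ≤ k * m l ∧ k * m l - k * C ≤ m (k * l) := by
    induction k with
    | zero => simp [h0]
    | succ k ih =>
      have h1 := hle (k * l) l
      have h2 := hge (k * l) l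
      rw [add_mul, one_mul]
      push_cast
      constructor <;> linarith [ih.1, ih.2]
  obtain ⟨v, -, hv⟩ := exists_limit_of_abs_mul_sub_le (g := fun n => m n / n)
    (r := fun n => (n : ℝ)) (K := C) tendsto_natCast_atTop_atTop (by
      intro k l hk1 hl1
      have hk0 : (0 : ℝ) < k := by exact_mod_cast hk1
      have hl0 : (0 : ℝ) < l := by exact_mod_cast hl1
      have e : m (k * l) / ((k * l : ℕ) : ℝ) - m l / l = (m (k * l) - k * m l) / (k * l) := by
        push_cast
        field_simp
      rw [e, abs_div, abs_of_pos (mul_pos hk0 hl0), div_le_div_iff₀ (mul_pos hk0 hl0) hl0]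
      have : |m (k * l) - k * m l| ≤ k * C := by
        rw [abs_le]; constructor <;> linarith [(hk l k).1, (hk l k).2]
      calc _ ≤ (k * C) * l := by gcongr
        _ = _ := by ring)
  refine ⟨v, fun n => ?_⟩
  rcases Nat.eq_zero_or_pos n with rfl | hn
  · simpa [h0] using hC
  · have hn0 : (0 : ℝ) < n := by exact_mod_cast hn
    have h := hv n hn
    rw [abs_sub_comm, le_div_iff₀ hn0] at h
    calc |m n - v * n| = |(m n / n - v) * n| := by rw [sub_mul, div_mul_cancel₀ _ hn0.ne']
      _ = |m n / n - v| * n := by rw [abs_mul, abs_of_pos hn0]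
      _ ≤ C := h

/-- Induction step for a bound of the form `20 * c * (√k - 1)`, with `s`, `t`, `u` the square roots
of the two halves and of the whole. The `-1` provides the slack: the Euclidean norm of `(s - 1, t -
1)` is at most `u - 1.05`, and the spare `0.05`, multiplied by `20 * c`, pays for the junction error
`c`. -/
lemma sqrt_sq_add_sq_add_le {s t u c : ℝ} (hc : 0 ≤ c) (hs : 1 ≤ s) (hst : s ≤ t)
    (hts : t ^ 2 ≤ s ^ 2 + 1) (hu : 0 ≤ u) (huu : u ^ 2 = s ^ 2 + t ^ 2) :
    √((20 * c * (s - 1)) ^ 2 + (20 * c * (t - 1)) ^ 2) + c ≤ 20 * c * (u - 1) := by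
  have hy : t - s ≤ 1 / 2 := by nlinarith
  -- Nearly tight at `s = t = 1`, where `u = √2`; this limits the available gain and hence dictates
  -- constants such as `20`.
  have key : 1.05 * u + 0.5 ≤ s + t := by
    have : 1.05 * u ≤ s + t - 0.5 := by
      refine abs_le_of_sq_le_sq' ?_ (by linarith) |>.2
      obtain ⟨x, rfl⟩ : ∃ x, s = 1 + x := ⟨s - 1, by ring⟩
      obtain ⟨y, rfl⟩ : ∃ y, t = 1 + y := ⟨t - 1, by ring⟩
      have hx : 0 ≤ x := by linarith
      have hxy : x ≤ y := by linarith
      nlinarith [mul_nonneg hx (sub_nonneg.2 hxy), mul_nonneg (hx.trans hxy)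
        (by linarith : 0 ≤ x + 1 / 2 - y), mul_nonneg hx (hx.trans hxy)]
    linarith
  have hu1 : 1.05 ≤ u := by nlinarith
  have h1 : √((20 * c * (s - 1)) ^ 2 + (20 * c * (t - 1)) ^ 2) ≤ 20 * c * (u - 1.05) := by
    refine Real.sqrt_le_iff.2 ⟨by nlinarith, ?_⟩
    have h2 : (s - 1) ^ 2 + (t - 1) ^ 2 ≤ (u - 1.05) ^ 2 := by nlinarith
    calc _ = (20 * c) ^ 2 * ((s - 1) ^ 2 + (t - 1) ^ 2) := by ring
      _ ≤ (20 * c) ^ 2 * (u - 1.05) ^ 2 := by gcongr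
      _ = _ := by ring
  linarith

end RealSequences

/-! ### Mean and variance of the front. -/

section Front

variable {N : ℕ} [NeZero N] {Ω : Type*} [MeasurableSpace Ω] {P : Measure Ω}
  [IsProbabilityMeasure P] {A : ℕ → Ω → Fin N → Fin N → ℝ}

lemma dependsOnPrefix_front (n : ℕ) :
    DependsOnPrefix (fun a : ℕ → Fin N → Fin N → ℝ => front a n) n :=
  fun _ _ h => front_congr h

lemma dependsOnPrefix_defect (l k : ℕ) :
    DependsOnPrefix (fun a : ℕ → Fin N → Fin N → ℝ => defect l a k) (k * l) :=
  fun _ _ h => defect_congr h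

omit [NeZero N] [IsProbabilityMeasure P] in
lemma memLp_norm {p : ENNReal} (hid : ∀ k, IdentDistrib (A k) (A 0) P P)
    (h : MemLp (fun ω => ‖A 0 ω‖) p P) (k : ℕ) : MemLp (fun ω => ‖A k ω‖) p P :=
  ((hid k).comp measurable_norm).memLp_iff.2 h

omit [IsProbabilityMeasure P] in
lemma memLp_front {p : ENNReal} (hA : ∀ k, Measurable (A k))
    (hid : ∀ k, IdentDistrib (A k) (A 0) P P) (h : MemLp (fun ω => ‖A 0 ω‖) p P) (n : ℕ) :
    MemLp (fun ω => front (fun k => A k ω) n) p P := by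
  refine (memLp_finsetSum (Finset.range n) fun k _ => memLp_norm hid h k).mono'
    ((measurable_front n).comp (measurable_pi_lambda _ hA)).aestronglyMeasurable
    (.of_forall fun ω => ?_)
  exact abs_front_le _ n

omit [IsProbabilityMeasure P] in
lemma identDistrib_front_shift (hA : ∀ k, Measurable (A k)) (hind : iIndepFun A P)
    (hid : ∀ k, IdentDistrib (A k) (A 0) P P) (s n : ℕ) :
    IdentDistrib (fun ω => front (fun k => A (s + k) ω) n)
      (fun ω => front (fun k => A k ω) n) P P :=
  (identDistrib_shift hA hind hid s).comp (measurable_front n)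

omit [IsProbabilityMeasure P] in
/-- The mean of the front grows linearly, up to a bounded error. -/
lemma exists_speed (hA : ∀ k, Measurable (A k)) (hind : iIndepFun A P)
    (hid : ∀ k, IdentDistrib (A k) (A 0) P P) (h : Integrable (fun ω => ‖A 0 ω‖) P) :
    ∃ v : ℝ, ∀ n : ℕ,
      |∫ ω, front (fun k => A k ω) n ∂P - v * n| ≤ 2 * ∫ ω, ‖A 0 ω‖ ∂P := by
  rw [← memLp_one_iff_integrable] at h
  have hF (n : ℕ) : Integrable (fun ω => front (fun k => A k ω) n) P :=
    memLp_one_iff_integrable.1 (memLp_front hA hid h n)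
  have hs (s n : ℕ) := identDistrib_front_shift hA hind hid s n
  have hFs (s n : ℕ) : Integrable (fun ω => front (fun k => A (s + k) ω) n) P :=
    (hs s n).integrable_iff.2 (hF n)
  have hn (s : ℕ) : Integrable (fun ω => 2 * ‖A s ω‖) P :=
    (memLp_one_iff_integrable.1 (memLp_norm hid h s)).const_mul 2
  refine exists_rate_of_almost_additive (by simp [front_zero]) (fun n k => ?_) fun n k => ?_
  · rw [← (hs n k).integral_eq, ← integral_add (hF n) (hFs n k)]
    exact integral_mono (hF _) ((hF n).add (hFs n k)) fun ω => front_add_le _ n k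
  · have hadd : Integrable (fun ω => front (fun k => A k ω) n +
        front (fun i => A (n + i) ω) k) P := (hF n).add (hFs n k)
    have e : ∫ ω, ‖A 0 ω‖ ∂P = ∫ ω, ‖A n ω‖ ∂P :=
      ((hid n).comp measurable_norm).integral_eq.symm
    rw [← (hs n k).integral_eq, ← integral_add (hF n) (hFs n k), e, ← integral_const_mul,
      ← integral_sub hadd (hn n)]
    exact integral_mono (hadd.sub (hn n)) (hF _) fun ω => le_front_add _ n k

omit [IsProbabilityMeasure P] in
lemma memLp_defect {p : ENNReal} (hA : ∀ k, Measurable (A k))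
    (hid : ∀ k, IdentDistrib (A k) (A 0) P P) (h : MemLp (fun ω => ‖A 0 ω‖) p P) (l k : ℕ) :
    MemLp (fun ω => defect l (fun k => A k ω) k) p P := by
  refine (memLp_finsetSum (Finset.range k) fun j _ =>
    (memLp_norm hid h (j * l)).const_mul 2).mono'
    ((measurable_defect l k).comp (measurable_pi_lambda _ hA)).aestronglyMeasurable
    (.of_forall fun ω => ?_)
  have := defect_nonpos_and_ge l (fun k => A k ω) k
  rw [Real.norm_eq_abs, abs_of_nonpos this.1]
  linarith [this.2]

/-- The size of the fluctuations created by restarting the system at a given time. -/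
noncomputable def restartSize (A : ℕ → Ω → Fin N → Fin N → ℝ) (P : Measure Ω) : ℝ :=
  √(∫ ω, (2 * ‖A 0 ω‖) ^ 2 ∂P)

/-- The sum of the fronts over `k` blocks approximates the front up to an error of order `√k`,
uniformly in the length of the blocks. -/
lemma stdDev_defect_le (hA : ∀ k, Measurable (A k)) (hind : iIndepFun A P)
    (hid : ∀ k, IdentDistrib (A k) (A 0) P P) (h : MemLp (fun ω => ‖A 0 ω‖) 2 P) (l k : ℕ)
    (hk : 1 ≤ k) :
    stdDev (fun ω => defect l (fun i => A i ω) k) P ≤ 20 * restartSize A P * (√k - 1) := by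
  induction k using Nat.strong_induction_on with
  | _ k ih =>
  rcases hk.eq_or_lt with rfl | hk1
  · simp [defect_one, stdDev, show (fun _ : Ω => (0 : ℝ)) = 0 from rfl]
  -- Split the blocks into two halves differing by at most one block, as `sqrt_sq_add_sq_add_le`
  -- needs.
  obtain ⟨p, q, rfl, hp, hpq, hqp⟩ : ∃ p q, k = p + q ∧ 1 ≤ p ∧ p ≤ q ∧ q ≤ p + 1 :=
    ⟨k / 2, k - k / 2, by omega, by omega, by omega, by omega⟩
  have hMp := memLp_defect hA hid h l p
  have hidq : IdentDistrib (fun ω => defect l (fun i => A (p * l + i) ω) q)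
      (fun ω => defect l (fun i => A i ω) q) P P :=
    (identDistrib_shift hA hind hid (p * l)).comp (measurable_defect l q)
  have hMq := hidq.memLp_iff.2 (memLp_defect hA hid h l q)
  have hshift := identDistrib_front_shift hA hind hid (p * l) (q * l)
  have hMe : MemLp (fun ω => front (fun i => A i ω) (p * l + q * l) -
      front (fun i => A i ω) (p * l) - front (fun i => A (p * l + i) ω) (q * l)) 2 P :=
    ((memLp_front hA hid h _).sub (memLp_front hA hid h _)).sub
      (hshift.memLp_iff.2 (memLp_front hA hid h _))
  have he : stdDev (fun ω => front (fun i => A i ω) (p * l + q * l) -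
      front (fun i => A i ω) (p * l) - front (fun i => A (p * l + i) ω) (q * l)) P ≤
      restartSize A P := by
    have e : restartSize A P = √(∫ ω, (2 * ‖A (p * l) ω‖) ^ 2 ∂P) := by
      rw [restartSize]
      congr 1
      exact ((hid (p * l)).comp (u := fun a => (2 * ‖a‖) ^ 2) (by fun_prop)).integral_eq.symm
    rw [e]
    refine stdDev_le_of_abs_le hMe.1 ((memLp_norm hid h (p * l)).const_mul 2) fun ω => ?_
    have h1 := front_add_le (fun i => A i ω) (p * l) (q * l)
    have h2 := le_front_add (fun i => A i ω) (p * l) (q * l)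
    rw [abs_le]
    constructor <;> linarith [norm_nonneg (A (p * l) ω)]
  have hindep := indepFun_prefix_suffix hA hind (measurable_defect l p) (measurable_defect l q)
    (dependsOnPrefix_defect l p) (dependsOnPrefix_defect l q)
  have e : (fun ω => defect l (fun i => A i ω) (p + q)) =
      ((fun ω => defect l (fun i => A i ω) p) +
        fun ω => defect l (fun i => A (p * l + i) ω) q) +
      fun ω => front (fun i => A i ω) (p * l + q * l) -
        front (fun i => A i ω) (p * l) - front (fun i => A (p * l + i) ω) (q * l) := by
    ext ω
    exact defect_add l _ p q
  rw [e]
  refine (stdDev_add_le (hMp.add hMq) hMe).trans ?_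
  -- The halves involve disjoint stretches of noise, so their standard deviations add in quadrature.
  -- The plain triangle inequality would give order `k` instead of `√k`.
  have hsum : stdDev ((fun ω => defect l (fun i => A i ω) p) +
        fun ω => defect l (fun i => A (p * l + i) ω) q) P =
      √(stdDev (fun ω => defect l (fun i => A i ω) p) P ^ 2 +
        stdDev (fun ω => defect l (fun i => A i ω) q) P ^ 2) := by
    rw [stdDev_sq, stdDev_sq, ← hidq.variance_eq, ← hindep.variance_add hMp hMq, stdDev]
  have hc : 0 ≤ restartSize A P := Real.sqrt_nonneg _
  have hp' : (1 : ℝ) ≤ p := by exact_mod_cast hp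
  have hpq' : (p : ℝ) ≤ q := by exact_mod_cast hpq
  have hqp' : (q : ℝ) ≤ p + 1 := by exact_mod_cast hqp
  have key := sqrt_sq_add_sq_add_le (s := √p) (t := √q) (u := √(p + q)) hc
    (Real.one_le_sqrt.2 hp') (Real.sqrt_le_sqrt hpq')
    (by rw [Real.sq_sqrt, Real.sq_sqrt] <;> linarith) (Real.sqrt_nonneg _)
    (by rw [Real.sq_sqrt, Real.sq_sqrt, Real.sq_sqrt] <;> linarith)
  push_cast
  refine le_trans (add_le_add ?_ he) key
  rw [hsum]
  have h1 := ih p (by omega) hp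
  have h2 := ih q (by omega) (by omega)
  have h3 := stdDev_nonneg (fun ω => defect l (fun i => A i ω) p) (P := P)
  have h4 := stdDev_nonneg (fun ω => defect l (fun i => A i ω) q) (P := P)
  gcongr

omit [IsProbabilityMeasure P] in
lemma stdDev_sum_blocks (hA : ∀ k, Measurable (A k)) (hind : iIndepFun A P)
    (hid : ∀ k, IdentDistrib (A k) (A 0) P P) (h : MemLp (fun ω => ‖A 0 ω‖) 2 P) (l k : ℕ) :
    stdDev (fun ω => ∑ j ∈ Finset.range k, front (fun i => A (j * l + i) ω) l) P =
      √k * stdDev (fun ω => front (fun i => A i ω) l) P := by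
  have hs (j : ℕ) := identDistrib_front_shift hA hind hid (j * l) l
  have hM (j : ℕ) := (hs j).memLp_iff.2 (memLp_front hA hid h l)
  have hi := iIndepFun_blocks hA hind (measurable_front l) (dependsOnPrefix_front l)
  have hv := IndepFun.variance_sum (s := Finset.range k) (fun j _ => hM j)
    fun i _ j _ hij => hi.indepFun hij
  simp_rw [(hs _).variance_eq] at hv
  rw [Finset.sum_const, Finset.card_range, nsmul_eq_mul] at hv
  rw [stdDev, stdDev, ← Real.sqrt_mul (Nat.cast_nonneg k), ← hv]
  congr 2
  ext ω
  simp

/-- The variance of the front divided by the time converges. -/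
lemma exists_diffusivity (hA : ∀ k, Measurable (A k)) (hind : iIndepFun A P)
    (hid : ∀ k, IdentDistrib (A k) (A 0) P P) (h : MemLp (fun ω => ‖A 0 ω‖) 2 P) :
    ∃ σ : ℝ, Tendsto (fun n : ℕ => stdDev (fun ω => front (fun i => A i ω) n) P / √n)
      atTop (𝓝 σ) := by
  obtain ⟨σ, hσ, -⟩ := exists_limit_of_abs_mul_sub_le
    (g := fun n : ℕ => stdDev (fun ω => front (fun i => A i ω) n) P / √n)
    (r := fun n : ℕ => √n) (K := 20 * restartSize A P)
    (Real.tendsto_sqrt_atTop.comp tendsto_natCast_atTop_atTop) (by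
      intro k l hk hl
      have hk0 : 0 < √(k : ℝ) := Real.sqrt_pos.2 (by exact_mod_cast hk)
      have hl0 : 0 < √(l : ℝ) := Real.sqrt_pos.2 (by exact_mod_cast hl)
      have hs := stdDev_sum_blocks hA hind hid h l k
      have hMS : MemLp (fun ω => ∑ j ∈ Finset.range k, front (fun i => A (j * l + i) ω) l) 2 P :=
        memLp_finsetSum _ fun j _ =>
          (identDistrib_front_shift hA hind hid (j * l) l).memLp_iff.2 (memLp_front hA hid h l)
      -- The block sum has standard deviation `√k` times that of one block, and differs from the
      -- front by the defect. Dividing by `√(k * l)` leaves an error of order `1 / √l`.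
      have hd := abs_stdDev_sub_le (memLp_front hA hid h (k * l)) hMS
      have hd' := hd.trans (stdDev_defect_le hA hind hid h l k hk)
      rw [hs] at hd'
      have hc : 0 ≤ restartSize A P := Real.sqrt_nonneg _
      push_cast
      rw [Real.sqrt_mul (Nat.cast_nonneg k)]
      have e (x y : ℝ) : x / (√k * √l) - y / √l = (x - √k * y) / (√k * √l) := by
        field_simp
      rw [e, abs_div, abs_of_pos (mul_pos hk0 hl0), div_le_div_iff₀ (mul_pos hk0 hl0) hl0]
      calc _ ≤ (20 * restartSize A P * (√k - 1)) * √l := by gcongr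
        _ ≤ 20 * restartSize A P * (√k * √l) := by
          have : 0 ≤ restartSize A P * √l := by positivity
          nlinarith)
  exact ⟨σ, hσ⟩

end Front

/-! ### Law of large numbers for the front. -/

section LimitTheorems

variable {N : ℕ} [NeZero N] {Ω : Type*} [MeasurableSpace Ω] {P : Measure Ω}
  {A : ℕ → Ω → Fin N → Fin N → ℝ}

lemma tendsto_natDiv_atTop {l : ℕ} (hl : 1 ≤ l) : Tendsto (fun t : ℕ => t / l) atTop atTop :=
  tendsto_atTop.2 fun b => (eventually_ge_atTop (b * l)).mono fun t ht =>
    (Nat.le_div_iff_mul_le (by omega)).2 ht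

lemma tendsto_natDiv_div {l : ℕ} (hl : 1 ≤ l) :
    Tendsto (fun t : ℕ => ((t / l : ℕ) : ℝ) / t) atTop (𝓝 (1 / l)) := by
  have h := (tendsto_nat_floor_mul_div_atTop (R := ℝ) (a := 1 / l) (by positivity)).comp
    tendsto_natCast_atTop_atTop
  refine h.congr fun t => ?_
  simp only [Function.comp_apply]
  rw [← Nat.floor_div_eq_div (K := ℝ)]
  congr 3
  ring

/-- The part of the noise after the last complete block. -/
lemma abs_front_sub_front_block_le (a : ℕ → Fin N → Fin N → ℝ) {l : ℕ} (hl : 1 ≤ l) (t : ℕ) :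
    |front a t - front a (t / l * l)| ≤ ∑ i ∈ Finset.range l, ‖a (t / l * l + i)‖ := by
  have h := abs_front_add_sub_le a (t / l * l) (t % l)
  rw [Nat.div_add_mod'] at h
  refine h.trans (Finset.sum_le_sum_of_subset_of_nonneg ?_ fun _ _ _ => norm_nonneg _)
  exact Finset.range_subset_range.2 (Nat.mod_lt _ (by omega)).le

omit [NeZero N] in
/-- The strong law for functionals of disjoint blocks. -/
lemma strong_law_blocks (hA : ∀ k, Measurable (A k)) (hind : iIndepFun A P)
    (hid : ∀ k, IdentDistrib (A k) (A 0) P P) {f : (ℕ → Fin N → Fin N → ℝ) → ℝ}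
    (hf : Measurable f) {l : ℕ} (hfl : DependsOnPrefix f l)
    (hint : Integrable (fun ω => f fun k => A k ω) P) :
    ∀ᵐ ω ∂P, Tendsto (fun k : ℕ => (∑ j ∈ Finset.range k, f fun i => A (j * l + i) ω) / k) atTop
      (𝓝 (∫ ω, f (fun k => A k ω) ∂P)) := by
  have hi := iIndepFun_blocks hA hind hf hfl
  have h := strong_law_ae_real (fun (j : ℕ) ω => f fun i => A (j * l + i) ω)
    (by simpa using hint) (fun i j hij => hi.indepFun hij) fun j => by
      simp only [zero_mul, zero_add]
      exact (identDistrib_shift hA hind hid (j * l)).comp hf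
  simpa using h

/-- Up to a factor tending to `1`, `u n / n` is the difference of two consecutive averages. -/
lemma tendsto_div_of_tendsto_sum_div {u : ℕ → ℝ} {c : ℝ}
    (h : Tendsto (fun n : ℕ => (∑ i ∈ Finset.range n, u i) / n) atTop (𝓝 c)) :
    Tendsto (fun n : ℕ => u n / n) atTop (𝓝 0) := by
  have h1 := h.comp (tendsto_add_atTop_nat 1)
  have h2 : Tendsto (fun n : ℕ => ((n + 1 : ℕ) : ℝ) / n) atTop (𝓝 1) := by
    have : Tendsto (fun n : ℕ => 1 + 1 / (n : ℝ)) atTop (𝓝 (1 + 0)) :=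
      tendsto_const_nhds.add tendsto_one_div_atTop_nhds_zero_nat
    rw [add_zero] at this
    refine this.congr' ((eventually_ge_atTop 1).mono fun n hn => ?_)
    have : (n : ℝ) ≠ 0 := by positivity
    push_cast
    field_simp
  have h3 := (h1.mul h2).sub h
  rw [mul_one, sub_self] at h3
  refine h3.congr' ((eventually_ge_atTop 1).mono fun n hn => ?_)
  have : (n : ℝ) ≠ 0 := by positivity
  have : ((n + 1 : ℕ) : ℝ) ≠ 0 := by positivity
  simp only [Function.comp_apply]
  rw [div_mul_div_cancel₀ this, ← sub_div, Finset.sum_range_succ, add_sub_cancel_left]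

omit [NeZero N] in
lemma ae_tendsto_norm_div (hind : iIndepFun A P)
    (hid : ∀ k, IdentDistrib (A k) (A 0) P P) (h : Integrable (fun ω => ‖A 0 ω‖) P) :
    ∀ᵐ ω ∂P, Tendsto (fun n : ℕ => ‖A n ω‖ / n) atTop (𝓝 0) := by
  have := strong_law_ae_real (fun n ω => ‖A n ω‖) h
    (fun i j hij => (hind.indepFun hij).comp measurable_norm measurable_norm)
    fun n => (hid n).comp measurable_norm
  exact this.mono fun ω hω => tendsto_div_of_tendsto_sum_div hω

/-- The law of large numbers for the front. -/
lemma ae_tendsto_front_div (hA : ∀ k, Measurable (A k)) (hind : iIndepFun A P)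
    (hid : ∀ k, IdentDistrib (A k) (A 0) P P) (h : Integrable (fun ω => ‖A 0 ω‖) P)
    {v C : ℝ} (hv : ∀ n : ℕ, |∫ ω, front (fun k => A k ω) n ∂P - v * n| ≤ C) :
    ∀ᵐ ω ∂P, Tendsto (fun t : ℕ => front (fun k => A k ω) t / t) atTop (𝓝 v) := by
  have h1 := memLp_one_iff_integrable.2 h
  set c := ∫ ω, 2 * ‖A 0 ω‖ ∂P with hc
  have hc0 : 0 ≤ c := integral_nonneg fun ω => by positivity
  have hC0 : 0 ≤ C := (abs_nonneg _).trans (hv 0)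
  -- For fixed `l`: `C` accounts for the error in the mean of one block, `c` for the junctions, and
  -- `1` absorbs the terms that vanish as `t → ∞`. Letting `l → ∞` comes afterwards.
  have key : ∀ l : ℕ, 1 ≤ l → ∀ᵐ ω ∂P, ∀ᶠ t : ℕ in atTop,
      |front (fun k => A k ω) t / t - v| ≤ (C + c + 1) / l := by
    intro l hl
    have hm : Measurable fun a : ℕ → Fin N → Fin N → ℝ => ∑ i ∈ Finset.range l, ‖a i‖ := by
      fun_prop
    -- Three strong laws: for the block fronts, for the junction errors, and for the total noise of
    -- a block. The last is used only to show that an incomplete final block is negligible.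
    filter_upwards [strong_law_blocks hA hind hid (measurable_front l) (dependsOnPrefix_front l)
        (memLp_one_iff_integrable.1 (memLp_front hA hid h1 l)),
      strong_law_blocks hA hind hid (f := fun a => 2 * ‖a 0‖) (l := l) (by fun_prop)
        (fun a b hab => by simp only [hab 0 hl]) (h.const_mul 2),
      strong_law_blocks hA hind hid hm
        (fun a b hab => Finset.sum_congr rfl fun i hi => by rw [hab i (Finset.mem_range.1 hi)])
        (integrable_finsetSum _ fun i _ => memLp_one_iff_integrable.1 (memLp_norm hid h1 i))]
      with ω hS hW hU
    have hU0 := tendsto_div_of_tendsto_sum_div hU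
    have hvl : Tendsto (fun k : ℕ => |v| * l / (k : ℝ)) atTop (𝓝 0) :=
      tendsto_const_div_atTop_nhds_zero_nat _
    set m := ∫ ω, front (fun k => A k ω) l ∂P with hm
    have hlim : Tendsto (fun k : ℕ =>
        |(∑ j ∈ Finset.range k, front (fun i => A (j * l + i) ω) l) / k - m| + C +
          (∑ j ∈ Finset.range k, 2 * ‖A (j * l + 0) ω‖) / k +
          (∑ i ∈ Finset.range l, ‖A (k * l + i) ω‖) / k + |v| * l / k) atTop
        (𝓝 (|m - m| + C + c + 0 + 0)) :=
      (((((hS.sub_const m).abs).add_const C).add hW).add hU0).add hvl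
    rw [sub_self, abs_zero, zero_add, add_zero, add_zero] at hlim
    have hev := (tendsto_natDiv_atTop hl).eventually
      (hlim.eventually (gt_mem_nhds (lt_add_one (C + c))))
    filter_upwards [hev, eventually_ge_atTop l] with t ht htl
    set k := t / l with hk
    have hk1 : 1 ≤ k := (Nat.le_div_iff_mul_le (by omega)).2 (by omega)
    have hk0 : (0 : ℝ) < k := by exact_mod_cast hk1
    have hl0 : (0 : ℝ) < l := by exact_mod_cast hl
    have ht0 : (0 : ℝ) < t := by exact_mod_cast (by omega : 0 < t)
    have htk : (k : ℝ) * l ≤ t := by exact_mod_cast Nat.div_mul_le_self t l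
    have htk' : (t : ℝ) ≤ k * l + l := by
      have : t ≤ k * l + l := by
        have := Nat.lt_div_mul_add (a := t) (b := l) (by omega)
        rw [← hk] at this
        exact this.le
      exact_mod_cast this
    set S := ∑ j ∈ Finset.range k, front (fun i => A (j * l + i) ω) l with hSdef
    set W := ∑ j ∈ Finset.range k, 2 * ‖A (j * l + 0) ω‖ with hWdef
    set U := ∑ i ∈ Finset.range l, ‖A (k * l + i) ω‖ with hUdef
    have hdef := defect_nonpos_and_ge l (fun k => A k ω) k
    have hFU := abs_front_sub_front_block_le (fun k => A k ω) hl t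
    rw [← hk, ← hUdef] at hFU
    rw [defect, ← hSdef] at hdef
    have hW' : ∑ j ∈ Finset.range k, 2 * ‖A (j * l) ω‖ = W := by simp [hWdef]
    rw [hW'] at hdef
    have hbound : |front (fun k => A k ω) t - v * t| ≤
        |S - k * m| + k * C + W + U + |v| * l := by
      have e : front (fun k => A k ω) t - v * t =
          (front (fun k => A k ω) t - front (fun k => A k ω) (k * l)) +
          (front (fun k => A k ω) (k * l) - S) + (S - k * m) + k * (m - v * l) -
          v * (t - k * l) := by ring
      rw [e]
      have b1 : |front (fun k => A k ω) (k * l) - S| ≤ W := by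
        rw [abs_le]; constructor <;> linarith [hdef.1, hdef.2]
      have b2 : |k * (m - v * l)| ≤ k * C := by
        rw [abs_mul, abs_of_pos hk0]
        exact mul_le_mul_of_nonneg_left (hv l) hk0.le
      have b3 : |v * (t - k * l)| ≤ |v| * l := by
        rw [abs_mul]
        refine mul_le_mul_of_nonneg_left ?_ (abs_nonneg v)
        rw [abs_le]; constructor <;> linarith
      refine (abs_sub _ _).trans ?_
      have a1 := abs_add_le (front (fun k => A k ω) t - front (fun k => A k ω) (k * l) +
          (front (fun k => A k ω) (k * l) - S) + (S - k * m)) (k * (m - v * l))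
      have a2 := abs_add_le (front (fun k => A k ω) t - front (fun k => A k ω) (k * l) +
          (front (fun k => A k ω) (k * l) - S)) (S - k * m)
      have a3 := abs_add_le (front (fun k => A k ω) t - front (fun k => A k ω) (k * l))
          (front (fun k => A k ω) (k * l) - S)
      linarith
    have e1 : |S / k - m| + C + W / k + U / k + |v| * l / k =
        (|S - k * m| + k * C + W + U + |v| * l) / k := by
      have : S / k - m = (S - k * m) / k := by field_simp
      rw [this, abs_div, abs_of_pos hk0]
      field_simp
    rw [e1, div_lt_iff₀ hk0] at ht
    have e2 : front (fun k => A k ω) t / t - v = (front (fun k => A k ω) t - v * t) / t := by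
      field_simp
    rw [e2, abs_div, abs_of_pos ht0, div_le_div_iff₀ ht0 hl0]
    calc _ ≤ ((C + c + 1) * k) * l :=
          mul_le_mul_of_nonneg_right (hbound.trans ht.le) hl0.le
      _ = (C + c + 1) * (k * l) := by ring
      _ ≤ _ := by gcongr
  have key' : ∀ᵐ ω ∂P, ∀ l : ℕ, 1 ≤ l → ∀ᶠ t : ℕ in atTop,
      |front (fun k => A k ω) t / t - v| ≤ (C + c + 1) / l :=
    ae_all_iff.2 fun l => by
      by_cases hl : 1 ≤ l
      · exact (key l hl).mono fun ω h _ => h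
      · exact .of_forall fun ω h => absurd h hl
  filter_upwards [key'] with ω hω
  refine Metric.tendsto_nhds.2 fun ε hε => ?_
  obtain ⟨l, hl, hl1⟩ := (((tendsto_const_div_atTop_nhds_zero_nat (C + c + 1)).eventually
    (gt_mem_nhds hε)).and (eventually_ge_atTop 1)).exists
  exact (hω l hl1).mono fun t ht => ht.trans_lt hl

end LimitTheorems

/-! ### Central limit theorem for the front and positivity of its variance. -/

section CentralLimit

variable {N : ℕ} [NeZero N] {Ω : Type*} [MeasurableSpace Ω] {P : Measure Ω}
  [IsProbabilityMeasure P] {A : ℕ → Ω → Fin N → Fin N → ℝ}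

/-- Comparison of the rescaled front with the rescaled sum of the fronts over blocks. -/
lemma integral_abs_front_sub_sum_blocks_le (hA : ∀ k, Measurable (A k)) (hind : iIndepFun A P)
    (hid : ∀ k, IdentDistrib (A k) (A 0) P P) (h : MemLp (fun ω => ‖A 0 ω‖) 2 P)
    {v C : ℝ} (hv : ∀ n : ℕ, |∫ ω, front (fun k => A k ω) n ∂P - v * n| ≤ C)
    {l t : ℕ} (hl : 1 ≤ l) (hlt : l ≤ t) :
    ∫ ω, |(√t)⁻¹ * (front (fun k => A k ω) t - v * t) -
      (√l)⁻¹ * ((√(t / l : ℕ))⁻¹ * (∑ j ∈ Finset.range (t / l),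
        front (fun i => A (j * l + i) ω) l -
          (t / l : ℕ) * ∫ ω, front (fun i => A i ω) l ∂P))| ∂P ≤
    (20 * restartSize A P * √(t / l : ℕ) +
        √(∫ ω, (∑ i ∈ Finset.range l, ‖A i ω‖) ^ 2 ∂P) + C) / √t +
      |√(t / l : ℕ) / √t - 1 / √l| * stdDev (fun ω => front (fun i => A i ω) l) P := by
  set k := t / l with hk
  have hk1 : 1 ≤ k := (Nat.le_div_iff_mul_le (by omega)).2 (by omega)
  have hk0 : 0 < √(k : ℝ) := Real.sqrt_pos.2 (by exact_mod_cast hk1)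
  have hl0 : 0 < √(l : ℝ) := Real.sqrt_pos.2 (by exact_mod_cast hl)
  have ht0 : 0 < √(t : ℝ) := Real.sqrt_pos.2 (by exact_mod_cast (by omega : 0 < t))
  set F : ℕ → Ω → ℝ := fun n ω => front (fun i => A i ω) n with hF
  set S : Ω → ℝ := fun ω => ∑ j ∈ Finset.range k, front (fun i => A (j * l + i) ω) l with hS
  set m := ∫ ω, F l ω ∂P with hm
  have hs (j : ℕ) := identDistrib_front_shift hA hind hid (j * l) l
  have hMF (n : ℕ) : MemLp (F n) 2 P := memLp_front hA hid h n
  have hMS : MemLp S 2 P := memLp_finsetSum _ fun j _ => (hs j).memLp_iff.2 (hMF l)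
  have hES : P[S] = k * m := by
    rw [hS, integral_finsetSum _ fun j _ => ((hs j).memLp_iff.2 (hMF l)).integrable one_le_two]
    simp_rw [(hs _).integral_eq]
    rw [Finset.sum_const, Finset.card_range, nsmul_eq_mul]
  have hX : MemLp (F t - S) 2 P := (hMF t).sub hMS
  have hEX : P[F t - S] = P[F t] - k * m := by
    rw [integral_sub' ((hMF t).integrable one_le_two) (hMS.integrable one_le_two), hES]
  -- Front minus block sum consists of the incomplete last block, whose size is bounded for fixed
  -- `l`, and the defect, of order `√k`.
  have hsdX : stdDev (F t - S) P ≤ √(∫ ω, (∑ i ∈ Finset.range l, ‖A i ω‖) ^ 2 ∂P) +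
      20 * restartSize A P * √k := by
    have e : F t - S = (F t - F (k * l)) + fun ω => defect l (fun i => A i ω) k := by
      ext ω
      simp only [Pi.sub_apply, Pi.add_apply, defect, hF, hS]
      ring
    rw [e]
    refine (stdDev_add_le ((hMF t).sub (hMF _)) (memLp_defect hA hid h l k)).trans ?_
    refine add_le_add ?_ ((stdDev_defect_le hA hind hid h l k hk1).trans ?_)
    · have e2 : ∫ ω, (∑ i ∈ Finset.range l, ‖A i ω‖) ^ 2 ∂P =
          ∫ ω, (∑ i ∈ Finset.range l, ‖A (k * l + i) ω‖) ^ 2 ∂P :=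
        ((identDistrib_shift hA hind hid (k * l)).comp
          (u := fun a : ℕ → Fin N → Fin N → ℝ => (∑ i ∈ Finset.range l, ‖a i‖) ^ 2)
          (by fun_prop)).integral_eq.symm
      rw [e2]
      exact stdDev_le_of_abs_le ((hMF t).sub (hMF _)).1
        (memLp_finsetSum _ fun i _ => memLp_norm hid h _)
        fun ω => abs_front_sub_front_block_le _ hl t
    · have : 0 ≤ restartSize A P := Real.sqrt_nonneg _
      nlinarith
  have hsdS : stdDev S P = √k * stdDev (F l) P := stdDev_sum_blocks hA hind hid h l k
  have hpt (ω : Ω) : |(√t)⁻¹ * (F t ω - v * t) - (√l)⁻¹ * ((√k)⁻¹ * (S ω - k * m))| ≤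
      (√t)⁻¹ * (|(F t - S) ω - P[F t - S]| + C) +
        |(√t)⁻¹ - (√l)⁻¹ * (√k)⁻¹| * |S ω - P[S]| := by
    -- The error has three sources: the centred difference, the gap between the mean of the front
    -- and `v * t`, and the mismatch between the normalizations `√t` and `√(l * k)`.
    have e : (√t)⁻¹ * (F t ω - v * t) - (√l)⁻¹ * ((√k)⁻¹ * (S ω - k * m)) =
        (√t)⁻¹ * (((F t - S) ω - P[F t - S]) + (P[F t] - v * t)) +
          ((√t)⁻¹ - (√l)⁻¹ * (√k)⁻¹) * (S ω - P[S]) := by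
      rw [hEX, hES, Pi.sub_apply]
      ring
    rw [e]
    refine (abs_add_le _ _).trans (add_le_add ?_ (abs_mul _ _).le)
    rw [abs_mul, abs_of_pos (inv_pos.2 ht0)]
    gcongr
    exact (abs_add_le _ _).trans (by gcongr; exact hv t)
  have hi1 : Integrable (fun ω => |(F t - S) ω - P[F t - S]|) P :=
    ((hX.integrable one_le_two).sub (integrable_const _)).abs
  have hi2 : Integrable (fun ω => |S ω - P[S]|) P :=
    ((hMS.integrable one_le_two).sub (integrable_const _)).abs
  have hi3 : Integrable (fun ω => (√t)⁻¹ * (|(F t - S) ω - P[F t - S]| + C)) P :=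
    (hi1.add (integrable_const C)).const_mul _
  have hi4 := hi2.const_mul |(√t)⁻¹ - (√l)⁻¹ * (√k)⁻¹|
  have hi0 : Integrable (fun ω => |(√t)⁻¹ * (F t ω - v * t) -
      (√l)⁻¹ * ((√k)⁻¹ * (S ω - k * m))|) P :=
    (((((hMF t).integrable one_le_two).sub (integrable_const _)).const_mul _).sub
      ((((hMS.integrable one_le_two).sub (integrable_const _)).const_mul _).const_mul _)).abs
  refine (integral_mono hi0 (hi3.add hi4) hpt).trans ?_
  simp only [Pi.add_apply]
  rw [integral_add hi3 hi4, integral_const_mul, integral_const_mul,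
    integral_add hi1 (integrable_const C)]
  have e5 : |√k / √t - 1 / √l| = |(√t)⁻¹ - (√l)⁻¹ * (√k)⁻¹| * √k := by
    rw [← abs_of_pos hk0, ← abs_mul, abs_of_pos hk0]
    congr 1
    field_simp
  have e6 : |√k / √t - 1 / √l| * stdDev (fun ω => front (fun i => A i ω) l) P =
      |(√t)⁻¹ - (√l)⁻¹ * (√k)⁻¹| * stdDev S P := by rw [e5, mul_assoc, hsdS]
  rw [e6]
  refine add_le_add ?_ ?_
  · rw [div_eq_inv_mul, integral_const, probReal_univ, one_smul]
    gcongr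
    have := integral_abs_sub_integral_le hX
    linarith
  · gcongr
    exact integral_abs_sub_integral_le hMS

lemma tendsto_charFun_sum_blocks (hA : ∀ k, Measurable (A k)) (hind : iIndepFun A P)
    (hid : ∀ k, IdentDistrib (A k) (A 0) P P) (h : MemLp (fun ω => ‖A 0 ω‖) 2 P) (l : ℕ)
    (θ : ℝ) :
    Tendsto (fun k : ℕ => charFun (P.map fun ω => (√l)⁻¹ * ((√k)⁻¹ *
      (∑ j ∈ Finset.range k, front (fun i => A (j * l + i) ω) l -
          k * ∫ ω, front (fun i => A i ω) l ∂P))) θ) atTop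
      (𝓝 (Complex.exp (-(((stdDev (fun ω => front (fun i => A i ω) l) P / √l) ^ 2 * θ ^ 2 / 2 :
        ℝ) : ℂ)))) := by
  have hs (j : ℕ) := identDistrib_front_shift hA hind hid (j * l) l
  have hi := iIndepFun_blocks hA hind (measurable_front l) (dependsOnPrefix_front l)
  have e0 : (fun ω => front (fun i => A (0 * l + i) ω) l) = fun ω => front (fun i => A i ω) l := by
    simp
  have hclt := tendstoInDistribution_inv_sqrt_mul_sum_sub (P := P)
    (X := fun (j : ℕ) ω => front (fun i => A (j * l + i) ω) l) (Y := id)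
    (P' := gaussianReal 0 Var[fun ω => front (fun i => A i ω) l; P].toNNReal)
    (by rw [e0]; exact HasLaw.id) (by rw [e0]; exact memLp_front hA hid h l) hi
    (fun j => by rw [e0]; exact hs j)
  -- The extra factor `1 / √l` is absorbed into the argument of the characteristic function.
  have hcf := ProbabilityMeasure.tendsto_iff_tendsto_charFun.1 hclt.tendsto ((√l)⁻¹ * θ)
  simp only [ProbabilityMeasure.coe_mk, Measure.map_id, charFun_gaussianReal] at hcf
  rw [e0] at hcf
  have hlimit : Complex.exp (-(((stdDev (fun ω => front (fun i => A i ω) l) P / √l) ^ 2 * θ ^ 2 / 2 :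
        ℝ) : ℂ)) = Complex.exp ((((√l)⁻¹ * θ : ℝ) : ℂ) * ((0 : ℝ) : ℂ) * Complex.I -
        ((Var[fun ω => front (fun i => A i ω) l; P].toNNReal : ℝ) : ℂ) *
          (((√l)⁻¹ * θ : ℝ) : ℂ) ^ 2 / 2) := by
    congr 1
    rw [Real.coe_toNNReal _ (variance_nonneg _ _), ← stdDev_sq]
    push_cast
    ring
  rw [hlimit]
  refine hcf.congr fun k => ?_
  rw [← charFun_map_mul, Measure.map_map (by fun_prop)]
  · rfl
  · refine ((Finset.measurable_fun_sum _ fun j _ => ?_).sub_const _).const_mul _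
    exact (measurable_front l).comp (measurable_pi_lambda _ fun i => hA _)

/-- The central limit theorem for the front. -/
lemma tendstoInDistribution_front (hA : ∀ k, Measurable (A k)) (hind : iIndepFun A P)
    (hid : ∀ k, IdentDistrib (A k) (A 0) P P) (h : MemLp (fun ω => ‖A 0 ω‖) 2 P)
    {v C σ : ℝ} (hv : ∀ n : ℕ, |∫ ω, front (fun k => A k ω) n ∂P - v * n| ≤ C)
    (hσ : Tendsto (fun n : ℕ => stdDev (fun ω => front (fun i => A i ω) n) P / √n)
      atTop (𝓝 σ)) :
    TendstoInDistribution (fun (t : ℕ) ω => (√t)⁻¹ * (front (fun k => A k ω) t - v * t))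
      atTop (id : ℝ → ℝ) (fun _ => P) (gaussianReal 0 (σ ^ 2).toNNReal) where
  forall_aemeasurable t := ((((measurable_front t).comp
    (measurable_pi_lambda _ hA)).sub_const _).const_mul _).aemeasurable
  aemeasurable_limit := aemeasurable_id
  tendsto := by
    refine ProbabilityMeasure.tendsto_iff_tendsto_charFun.2 fun θ => ?_
    simp only [ProbabilityMeasure.coe_mk, Measure.map_id, charFun_gaussianReal]
    have hlimit : Complex.exp ((θ : ℂ) * ((0 : ℝ) : ℂ) * Complex.I -
        (((σ ^ 2).toNNReal : ℝ) : ℂ) * (θ : ℂ) ^ 2 / 2) =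
        Complex.exp (-((σ ^ 2 * θ ^ 2 / 2 : ℝ) : ℂ)) := by
      congr 1
      rw [Real.coe_toNNReal _ (sq_nonneg _)]
      push_cast
      ring
    rw [hlimit]
    have hrl : Tendsto (fun n : ℕ => √(n : ℝ)) atTop atTop :=
      Real.tendsto_sqrt_atTop.comp tendsto_natCast_atTop_atTop
    have hgauss : Tendsto (fun l : ℕ => Complex.exp (-(((stdDev (fun ω => front (fun i => A i ω) l)
        P / √l) ^ 2 * θ ^ 2 / 2 : ℝ) : ℂ))) atTop
        (𝓝 (Complex.exp (-((σ ^ 2 * θ ^ 2 / 2 : ℝ) : ℂ)))) := by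
      have hc : Continuous fun x : ℝ => Complex.exp (-((x ^ 2 * θ ^ 2 / 2 : ℝ) : ℂ)) := by
        fun_prop
      exact (hc.tendsto σ).comp hσ
    refine Metric.tendsto_nhds.2 fun ε hε => ?_
    have hsmall : Tendsto (fun l : ℕ => |θ| * (20 * restartSize A P / √l)) atTop (𝓝 0) := by
      simpa using (hrl.const_div_atTop (20 * restartSize A P)).const_mul |θ|
    -- Fix `l` first, so that the block Gaussian is near the target and the limiting approximation
    -- error is small; only then let `t → ∞`.
    obtain ⟨l, ⟨hl1, hl2⟩, hl⟩ := ((((Metric.tendsto_nhds.1 hgauss) (ε / 3) (by positivity)).and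
      (hsmall.eventually (gt_mem_nhds (by positivity : (0 : ℝ) < ε / 3)))).and
      (eventually_ge_atTop 1)).exists
    have hblocks := (tendsto_charFun_sum_blocks hA hind hid h l θ).comp (tendsto_natDiv_atTop hl)
    have hratio : Tendsto (fun t : ℕ => √((t / l : ℕ) : ℝ) / √t) atTop (𝓝 (1 / √l)) := by
      have := (Real.continuous_sqrt.tendsto _).comp (tendsto_natDiv_div hl)
      rw [Real.sqrt_div zero_le_one, Real.sqrt_one] at this
      refine this.congr fun t => ?_
      rw [Function.comp_apply, Real.sqrt_div (Nat.cast_nonneg _)]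
    -- For fixed `l`, the incomplete block and the mismatch of normalizations disappear, and only
    -- the junction contribution of order `1 / √l` remains.
    have herr : Tendsto (fun t : ℕ => |θ| * (20 * restartSize A P * (√((t / l : ℕ) : ℝ) / √t) +
          (√(∫ ω, (∑ i ∈ Finset.range l, ‖A i ω‖) ^ 2 ∂P) + C) / √t +
        |√((t / l : ℕ) : ℝ) / √t - 1 / √l| * stdDev (fun ω => front (fun i => A i ω) l) P))
        atTop (𝓝 (|θ| * (20 * restartSize A P * (1 / √l) + 0 +
          |1 / √l - 1 / √l| * stdDev (fun ω => front (fun i => A i ω) l) P))) :=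
      (((hratio.const_mul _).add (hrl.const_div_atTop _)).add
        (((hratio.sub_const _).abs).mul_const _)).const_mul _
    rw [sub_self, abs_zero, zero_mul, add_zero, add_zero, mul_one_div] at herr
    filter_upwards [Metric.tendsto_nhds.1 hblocks (ε / 3) (by positivity),
      herr.eventually (gt_mem_nhds hl2), eventually_ge_atTop l] with t ht1 ht2 htl
    refine (dist_triangle4 _ (charFun (P.map fun ω => (√l)⁻¹ * ((√(t / l : ℕ))⁻¹ *
      (∑ j ∈ Finset.range (t / l), front (fun i => A (j * l + i) ω) l -
          (t / l : ℕ) * ∫ ω, front (fun i => A i ω) l ∂P))) θ)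
      (Complex.exp (-(((stdDev (fun ω => front (fun i => A i ω) l) P / √l) ^ 2 * θ ^ 2 / 2 :
        ℝ) : ℂ))) _).trans_lt ?_
    have hMF (n : ℕ) := (memLp_front hA hid h n).integrable one_le_two
    have hcf := norm_charFun_map_sub_le (P := P)
      (X := fun ω => (√t)⁻¹ * (front (fun k => A k ω) t - v * t))
      (Y := fun ω => (√l)⁻¹ * ((√(t / l : ℕ))⁻¹ *
      (∑ j ∈ Finset.range (t / l), front (fun i => A (j * l + i) ω) l -
          (t / l : ℕ) * ∫ ω, front (fun i => A i ω) l ∂P)))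
      (((hMF t).sub (integrable_const _)).const_mul _)
      ((((integrable_finsetSum _ fun j _ =>
        (identDistrib_front_shift hA hind hid (j * l) l).integrable_iff.2 (hMF l)).sub
          (integrable_const _)).const_mul _).const_mul _) θ
    have hint := integral_abs_front_sub_sum_blocks_le hA hind hid h hv hl htl
    have h1 := hcf.trans (mul_le_mul_of_nonneg_left hint (abs_nonneg θ))
    rw [add_assoc (20 * restartSize A P * _), add_div, mul_div_assoc] at h1
    rw [← dist_eq_norm] at h1
    simp only [Function.comp_apply] at ht1
    linarith

/-- Raising all the noises of one step moves the front, which forces linear growth of its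
variance. -/
lemma variance_front_ge (hA : ∀ k, Measurable (A k)) (hind : iIndepFun A P)
    (hid : ∀ k, IdentDistrib (A k) (A 0) P P) (h : MemLp (fun ω => ‖A 0 ω‖) 2 P) {c₁ c₂ : ℝ}
    (hc : c₁ < c₂) (h₁ : P {ω | ∀ i j, A 0 ω i j ≤ c₁} ≠ 0)
    (h₂ : P {ω | ∀ i j, c₂ ≤ A 0 ω i j} ≠ 0) :
    ∃ u : ℝ, ∀ n : ℕ, (c₂ - c₁) ^ 2 * n ≤ Var[fun ω => front (fun i => A i ω) n; P] * u := by
  set low : Set (Fin N → Fin N → ℝ) := {a | ∀ i j, a i j ≤ c₁} with hlow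
  set high : Set (Fin N → Fin N → ℝ) := {a | ∀ i j, c₂ ≤ a i j} with hhigh
  have hmlow : MeasurableSet low := by
    simp only [hlow, Set.ofPred_forall]
    exact .iInter fun i => .iInter fun j => measurableSet_le (by fun_prop) measurable_const
  have hmhigh : MeasurableSet high := by
    simp only [hhigh, Set.ofPred_forall]
    exact .iInter fun i => .iInter fun j => measurableSet_le measurable_const (by fun_prop)
  set p₁ := P.real (A 0 ⁻¹' low) with hp₁
  set p₂ := P.real (A 0 ⁻¹' high) with hp₂
  have hp₁0 : 0 < p₁ := ENNReal.toReal_pos h₁ (measure_ne_top _ _)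
  have hp₂0 : 0 < p₂ := ENNReal.toReal_pos h₂ (measure_ne_top _ _)
  -- Normalized indicators: integrating against `I₂ - I₁` compares the conditional means given a
  -- high and given a low noise. The difference `φ` is centred.
  set I₁ : (Fin N → Fin N → ℝ) → ℝ := low.indicator fun _ => p₁⁻¹ with hI₁
  set I₂ : (Fin N → Fin N → ℝ) → ℝ := high.indicator fun _ => p₂⁻¹ with hI₂
  have hmI₁ : Measurable I₁ := measurable_const.indicator hmlow
  have hmI₂ : Measurable I₂ := measurable_const.indicator hmhigh
  have hEI₁ (k : ℕ) : ∫ ω, I₁ (A k ω) ∂P = 1 := by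
    refine ((hid k).comp hmI₁).integral_eq.trans ?_
    have : I₁ ∘ A 0 = (A 0 ⁻¹' low).indicator fun _ => p₁⁻¹ := rfl
    rw [this, integral_indicator_const _ (hA 0 hmlow), smul_eq_mul, mul_inv_cancel₀ hp₁0.ne']
  have hEI₂ (k : ℕ) : ∫ ω, I₂ (A k ω) ∂P = 1 := by
    refine ((hid k).comp hmI₂).integral_eq.trans ?_
    have : I₂ ∘ A 0 = (A 0 ⁻¹' high).indicator fun _ => p₂⁻¹ := rfl
    rw [this, integral_indicator_const _ (hA 0 hmhigh), smul_eq_mul, mul_inv_cancel₀ hp₂0.ne']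
  have hL₁ (k : ℕ) : MemLp (fun ω => I₁ (A k ω)) 2 P :=
    MemLp.indicator (hA k hmlow) (memLp_const _)
  have hL₂ (k : ℕ) : MemLp (fun ω => I₂ (A k ω)) 2 P :=
    MemLp.indicator (hA k hmhigh) (memLp_const _)
  set φ : (Fin N → Fin N → ℝ) → ℝ := fun a => I₂ a - I₁ a with hφ
  have hmφ : Measurable φ := hmI₂.sub hmI₁
  have hLφ (k : ℕ) : MemLp (fun ω => φ (A k ω)) 2 P := (hL₂ k).sub (hL₁ k)
  have hEφ (k : ℕ) : ∫ ω, φ (A k ω) ∂P = 0 := by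
    rw [integral_sub ((hL₂ k).integrable one_le_two) ((hL₁ k).integrable one_le_two), hEI₁, hEI₂,
      sub_self]
  have hcov (n j : ℕ) (hj : j < n) :
      c₂ - c₁ ≤ cov[fun ω => front (fun i => A i ω) n, fun ω => φ (A j ω); P] := by
    have hF := memLp_front hA hid h n
    -- `Q` silences the noise at time `j`, hence is independent of `A j`. By monotonicity the front
    -- is at most `Q + c₁` on the low event and at least `Q + c₂` on the high one.
    set Q : Ω → ℝ := fun ω => front (Function.update (fun i => A i ω) j fun _ _ => 0) n with hQ
    have hmupd : Measurable fun ω => Function.update (fun i => A i ω) j fun _ _ => (0 : ℝ) := by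
      refine measurable_pi_lambda _ fun k => ?_
      rcases eq_or_ne k j with rfl | hkj
      · simp only [Function.update_self]; exact measurable_const
      · simp only [Function.update_of_ne hkj]; exact hA k
    have hLQ : MemLp Q 2 P := by
      refine (memLp_finsetSum (Finset.range n) fun k _ => memLp_norm hid h k).mono'
        ((measurable_front n).comp hmupd).aestronglyMeasurable (.of_forall fun ω => ?_)
      refine (abs_front_le _ n).trans (Finset.sum_le_sum fun k _ => ?_)
      rcases eq_or_ne k j with rfl | hkj
      · rw [Function.update_self]
        exact (norm_zero (E := Fin N → Fin N → ℝ)).le.trans (norm_nonneg _)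
      · rw [Function.update_of_ne hkj]
    have hindQ : IndepFun Q (fun ω => φ (A j ω)) P := by
      have h0 := hind.indepFun_finset ((Finset.range n).erase j) {j} (by simp) hA
      let u (b : (Finset.range n).erase j → Fin N → Fin N → ℝ) (k : ℕ) : Fin N → Fin N → ℝ :=
        if h : k ∈ (Finset.range n).erase j then b ⟨k, h⟩ else 0
      have hu : Measurable u := measurable_pi_lambda _ fun k => by
        by_cases h : k ∈ (Finset.range n).erase j
        · simp only [u, h, dite_true]; exact measurable_pi_apply _
        · simp only [u, h, dite_false]; exact measurable_const
      convert h0.comp ((measurable_front n).comp hu)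
        (hmφ.comp (measurable_pi_apply ⟨j, Finset.mem_singleton_self j⟩)) using 1
      · ext ω
        refine front_congr fun k hk => ?_
        rcases eq_or_ne k j with rfl | hkj
        · rw [Function.update_self]
          simp only [u, Finset.mem_erase, ne_eq, not_true_eq_false, false_and, dite_false]
          rfl
        · simp [u, hkj, hk]
      · rfl
    have hQφ : ∫ ω, Q ω * φ (A j ω) ∂P = 0 := by
      have := hindQ.integral_mul_eq_mul_integral hLQ.1 (hLφ j).1
      rw [hEφ j, mul_zero] at this
      exact this
    rw [covariance_eq_sub hF (hLφ j), hEφ j, mul_zero, sub_zero]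
    have hi : Integrable (fun ω => Q ω * φ (A j ω)) P := hLQ.integrable_mul (hLφ j)
    have hi' : Integrable (fun ω => c₂ * I₂ (A j ω) - c₁ * I₁ (A j ω)) P :=
      (((hL₂ j).integrable one_le_two).const_mul _).sub
        (((hL₁ j).integrable one_le_two).const_mul _)
    have e : c₂ - c₁ = ∫ ω, (Q ω * φ (A j ω) + (c₂ * I₂ (A j ω) - c₁ * I₁ (A j ω))) ∂P := by
      rw [integral_add hi hi', hQφ, integral_sub (((hL₂ j).integrable one_le_two).const_mul _)
        (((hL₁ j).integrable one_le_two).const_mul _), integral_const_mul, integral_const_mul,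
        hEI₁, hEI₂]
      ring
    rw [e]
    refine integral_mono (hi.add hi') (hF.integrable_mul (hLφ j)) fun ω => ?_
    have hI₁0 : 0 ≤ I₁ (A j ω) := Set.indicator_nonneg (fun _ _ => (inv_pos.2 hp₁0).le) _
    have hI₂0 : 0 ≤ I₂ (A j ω) := Set.indicator_nonneg (fun _ _ => (inv_pos.2 hp₂0).le) _
    have hlowQ : A j ω ∈ low → front (fun i => A i ω) n ≤ Q ω + c₁ := fun hmem => by
      rw [hQ, ← front_update_const _ hj]
      refine front_mono (fun k i i' => ?_) n
      rcases eq_or_ne k j with rfl | hkj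
      · rw [Function.update_self]; exact hmem i i'
      · rw [Function.update_of_ne hkj]
    have hhighQ : A j ω ∈ high → Q ω + c₂ ≤ front (fun i => A i ω) n := fun hmem => by
      rw [hQ, ← front_update_const _ hj]
      refine front_mono (fun k i i' => ?_) n
      rcases eq_or_ne k j with rfl | hkj
      · rw [Function.update_self]; exact hmem i i'
      · rw [Function.update_of_ne hkj]
    have b₁ : front (fun i => A i ω) n * I₁ (A j ω) ≤ (Q ω + c₁) * I₁ (A j ω) := by
      by_cases hmem : A j ω ∈ low
      · exact mul_le_mul_of_nonneg_right (hlowQ hmem) hI₁0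
      · simp [hI₁, Set.indicator_of_notMem hmem]
    have b₂ : (Q ω + c₂) * I₂ (A j ω) ≤ front (fun i => A i ω) n * I₂ (A j ω) := by
      by_cases hmem : A j ω ∈ high
      · exact mul_le_mul_of_nonneg_right (hhighQ hmem) hI₂0
      · simp [hI₂, Set.indicator_of_notMem hmem]
    simp only [hφ, Pi.mul_apply]
    linarith
  refine ⟨Var[fun ω => φ (A 0 ω); P], fun n => ?_⟩
  have hF := memLp_front hA hid h n
  -- Cauchy–Schwarz against the sum of all `φ (A j)`: the covariance is at least `n * (c₂ - c₁)`,
  -- while the sum has variance only of order `n`, which forces linear growth of the variance of the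
  -- front.
  have hcs := covariance_sq_le hF
    (memLp_finsetSum (Finset.range n) fun j _ => hLφ j : MemLp (fun ω => ∑ j ∈ Finset.range n,
      φ (A j ω)) 2 P)
  have hv : Var[fun ω => ∑ j ∈ Finset.range n, φ (A j ω); P] = n * Var[fun ω => φ (A 0 ω); P] := by
    have := IndepFun.variance_sum (s := Finset.range n) (fun j _ => hLφ j)
      fun i _ j _ hij => (hind.indepFun hij).comp hmφ hmφ
    have hvj (j : ℕ) : Var[fun ω => φ (A j ω); P] = Var[fun ω => φ (A 0 ω); P] :=
      ((hid j).comp hmφ).variance_eq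
    simp_rw [hvj] at this
    rw [Finset.sum_const, Finset.card_range, nsmul_eq_mul] at this
    rw [← this]
    congr 1
    ext ω
    simp
  have hsum : n * (c₂ - c₁) ≤ cov[fun ω => front (fun i => A i ω) n,
      fun ω => ∑ j ∈ Finset.range n, φ (A j ω); P] := by
    rw [covariance_fun_sum_right' (fun j _ => hLφ j) hF]
    calc n * (c₂ - c₁) = ∑ _j ∈ Finset.range n, (c₂ - c₁) := by
          rw [Finset.sum_const, Finset.card_range, nsmul_eq_mul]
      _ ≤ _ := Finset.sum_le_sum fun j hj => hcov n j (Finset.mem_range.1 hj)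
  rcases Nat.eq_zero_or_pos n with rfl | hn
  · simp only [Nat.cast_zero, mul_zero]
    exact mul_nonneg (variance_nonneg _ _) (variance_nonneg _ _)
  have hn0 : (0 : ℝ) < n := by exact_mod_cast hn
  rw [hv] at hcs
  have h3 : (n * (c₂ - c₁)) ^ 2 ≤ Var[fun ω => front (fun i => A i ω) n; P] *
      (n * Var[fun ω => φ (A 0 ω); P]) :=
    (pow_le_pow_left₀ (mul_nonneg hn0.le (sub_pos.2 hc).le) hsum 2).trans hcs
  refine le_of_mul_le_mul_left ?_ hn0
  calc _ = (n * (c₂ - c₁)) ^ 2 := by ring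
    _ ≤ _ := h3
    _ = _ := by ring

/-- The diffusivity is positive if the noise is not constant. -/
lemma diffusivity_ne_zero (hA : ∀ k, Measurable (A k)) (hind : iIndepFun A P)
    (hid : ∀ k, IdentDistrib (A k) (A 0) P P) (h : MemLp (fun ω => ‖A 0 ω‖) 2 P) {c₁ c₂ : ℝ}
    (hc : c₁ < c₂) (h₁ : P {ω | ∀ i j, A 0 ω i j ≤ c₁} ≠ 0)
    (h₂ : P {ω | ∀ i j, c₂ ≤ A 0 ω i j} ≠ 0) {σ : ℝ}
    (hσ : Tendsto (fun n : ℕ => stdDev (fun ω => front (fun i => A i ω) n) P / √n)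
      atTop (𝓝 σ)) : σ ≠ 0 := by
  obtain ⟨u, hu⟩ := variance_front_ge hA hind hid h hc h₁ h₂
  rintro rfl
  have h1 := (hσ.pow 2).mul_const u
  have h2 : (c₂ - c₁) ^ 2 ≤ 0 ^ 2 * u := by
    refine ge_of_tendsto h1 ((eventually_ge_atTop 1).mono fun n hn => ?_)
    have hn0 : (0 : ℝ) < n := by exact_mod_cast hn
    rw [div_pow, Real.sq_sqrt hn0.le, stdDev_sq, div_mul_eq_mul_div, le_div_iff₀ hn0]
    exact hu n
  have : 0 < (c₂ - c₁) ^ 2 := by have := sub_pos.2 hc; positivity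
  linarith

end CentralLimit

/-! ### Invariant measures of a Markov kernel with a uniform minorization. -/

section Minorization

variable {α : Type*} [MeasurableSpace α]

lemma bind_add_kernel (κ : Kernel α α) (μ₁ μ₂ : Measure α) :
    (μ₁ + μ₂).bind κ = μ₁.bind κ + μ₂.bind κ := by
  ext s hs
  rw [Measure.add_apply, Measure.bind_apply hs κ.aemeasurable, Measure.bind_apply hs κ.aemeasurable,
    Measure.bind_apply hs κ.aemeasurable, lintegral_add_measure]

/-- A Markov kernel that dominates a fixed nonzero measure, uniformly in the starting point, has
exactly one invariant probability measure. -/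
lemma existsUnique_invariant_of_minorization {κ κ' : Kernel α α} [IsMarkovKernel κ]
    {η : Measure α} (hη : η ≠ 0) (h : ∀ x, κ x = η + κ' x) [Nonempty α] :
    ∃ ν : Measure α, (IsProbabilityMeasure ν ∧ Kernel.Invariant κ ν) ∧
      ∀ ν', IsProbabilityMeasure ν' ∧ Kernel.Invariant κ ν' → ν' = ν := by
  obtain ⟨x₀⟩ := ‹Nonempty α›
  set p := η Set.univ with hp
  have hp0 : p ≠ 0 := by rwa [hp, Ne, Measure.measure_univ_eq_zero]
  have hmass (x : α) : p + κ' x Set.univ = 1 := by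
    have := congrArg (fun μ => μ Set.univ) (h x)
    simpa using this.symm
  have hptop : p ≠ ⊤ := fun ht => by have := hmass x₀; simp [ht] at this
  have hq (x : α) : κ' x Set.univ = 1 - p := ENNReal.eq_sub_of_add_eq hptop
    (by rw [add_comm]; exact hmass x)
  have hp1 : p ≤ 1 := (hmass x₀) ▸ le_self_add
  set T : Measure α → Measure α := fun μ => μ.bind κ' with hT
  have hTu (μ : Measure α) : T μ Set.univ = (1 - p) * μ Set.univ := by
    rw [hT, Measure.bind_apply .univ κ'.aemeasurable]
    simp [hq]
  have hbind (μ : Measure α) (s : Set α) (hs : MeasurableSet s) :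
      μ.bind κ s = η s * μ Set.univ + T μ s := by
    rw [Measure.bind_apply hs κ.aemeasurable, hT, Measure.bind_apply hs κ'.aemeasurable]
    simp_rw [h, Measure.add_apply]
    rw [lintegral_add_left measurable_const, lintegral_const]
  -- The stationary law sorted by the time since the last renewal: renew according to `η`, then take
  -- `n` steps without renewal. The masses are geometric and sum to one.
  set ν : Measure α := Measure.sum fun n => T^[n] η with hν
  have hνp : IsProbabilityMeasure ν := by
    refine ⟨?_⟩
    have hn (n : ℕ) : (T^[n] η) Set.univ = (1 - p) ^ n * p := by
      induction n with
      | zero => simp [hp]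
      | succ n ih => rw [Function.iterate_succ_apply', hTu, ih, pow_succ']; ring
    rw [hν, Measure.sum_apply _ .univ]
    simp_rw [hn]
    rw [ENNReal.tsum_mul_right, ENNReal.tsum_geometric, ENNReal.sub_sub_cancel ENNReal.one_ne_top
      hp1, ENNReal.inv_mul_cancel hp0 hptop]
  refine ⟨ν, ⟨hνp, ?_⟩, ?_⟩
  · refine Measure.ext fun s hs => ?_
    rw [hbind ν s hs, measure_univ, mul_one, hT, Measure.bind_apply hs κ'.aemeasurable, hν,
      lintegral_sum_measure, Measure.sum_apply _ hs,
      tsum_eq_zero_add' (f := fun i => (T^[i] η) s) ENNReal.summable]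
    refine congrArg (η s + ·) (tsum_congr fun n => ?_)
    rw [Function.iterate_succ_apply', hT, Measure.bind_apply hs κ'.aemeasurable]
  · rintro ν' ⟨hν'p, hν'⟩
    have hrec : ν' = η + T ν' := by
      refine Measure.ext fun s hs => ?_
      rw [Measure.add_apply]
      conv_lhs => rw [← hν'.def]
      rw [hbind ν' s hs, measure_univ, mul_one]
    have hTadd (μ₁ μ₂ : Measure α) : T (μ₁ + μ₂) = T μ₁ + T μ₂ := bind_add_kernel κ' μ₁ μ₂
    have hadd (n : ℕ) (μ₁ μ₂ : Measure α) : T^[n] (μ₁ + μ₂) = T^[n] μ₁ + T^[n] μ₂ := by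
      induction n with
      | zero => rfl
      | succ n ih =>
        rw [Function.iterate_succ_apply', ih, hTadd,
          Function.iterate_succ_apply', Function.iterate_succ_apply']
    -- Unrolling invariance shows that any invariant law dominates all partial sums, hence `ν`; two
    -- probability measures so ordered coincide.
    have hpartial (n : ℕ) : ν' = ∑ k ∈ Finset.range n, T^[k] η + T^[n] ν' := by
      induction n with
      | zero => simp
      | succ n ih =>
        have h1 : T^[n] ν' = T^[n] η + T^[n + 1] ν' := by
          conv_lhs => rw [hrec]
          rw [hadd, Function.iterate_succ_apply]
        rw [Finset.sum_range_succ, add_assoc, ← h1]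
        exact ih
    refine (Measure.eq_of_le_of_isProbabilityMeasure (Measure.le_iff.2 fun s hs => ?_)).symm
    rw [hν, Measure.sum_apply _ hs]
    refine ENNReal.tsum_le_of_sum_range_le fun n => ?_
    conv_rhs => rw [hpartial n]
    rw [Measure.add_apply, Measure.finsetSum_apply]
    exact le_self_add

end Minorization

/-! ### Renewals of the process seen from the leading edge. -/

section InvariantLaw

/-- Permuting the coordinates preserves an i.i.d. law. -/
lemma measurePreserving_comp_perm {ι X : Type*} [Fintype ι] [MeasurableSpace X] (μ : Measure X)
    [SigmaFinite μ] (σ : Equiv.Perm ι) :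
    MeasurePreserving (fun b : ι → X => b ∘ σ) (Measure.pi fun _ => μ) (Measure.pi fun _ => μ) := by
  convert measurePreserving_piCongrLeft (fun _ : ι => μ) σ.symm using 1
  ext b i
  simp [MeasurableEquiv.piCongrLeft, Equiv.piCongrLeft_apply]

variable {N : ℕ} [NeZero N] (ρ : Measure ℝ) [IsProbabilityMeasure ρ]

instance isProbabilityMeasure_noiseLaw : IsProbabilityMeasure (noiseLaw N ρ) := by
  unfold noiseLaw; infer_instance

lemma measurable_edgeStep_left (y : EdgeSpace N) :
    Measurable fun a : Fin N → Fin N → ℝ => edgeStep a y := by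
  have h := (measurable_edgeStep (N := N)).comp (measurable_prodMk_right (y := y))
  exact h

instance isMarkovKernel_edgeKernel : IsMarkovKernel (edgeKernel N ρ) :=
  ⟨fun y => Measure.isProbabilityMeasure_map (measurable_edgeStep_left y).aemeasurable⟩

variable (N) in
/-- The noises for which every particle descends from the first one, whatever the positions of the
others behind it. -/
def renewalSet : Set (Fin N → Fin N → ℝ) := {a | ∀ i j, a i j ≤ a i 0}

lemma measurableSet_renewalSet : MeasurableSet (renewalSet N) := by
  simp only [renewalSet, Set.ofPred_forall]
  exact .iInter fun i => .iInter fun j => measurableSet_le (by fun_prop) (by fun_prop)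

/-- In each row some entry is maximal, and by exchangeability every index has the same probability
of being so; hence index `0` has positive probability, and the rows are independent. Ties are
allowed, so atoms of `ρ` do no harm. -/
lemma noiseLaw_renewalSet_ne_zero : noiseLaw N ρ (renewalSet N) ≠ 0 := by
  set R : Fin N → Set (Fin N → ℝ) := fun j => {b | ∀ k, b k ≤ b j} with hR
  have hRm (j : Fin N) : MeasurableSet (R j) := by
    simp only [hR, Set.ofPred_forall]
    exact .iInter fun k => measurableSet_le (by fun_prop) (by fun_prop)
  have hRj (j : Fin N) : Measure.pi (fun _ : Fin N => ρ) (R j) =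
      Measure.pi (fun _ : Fin N => ρ) (R 0) := by
    rw [← (measurePreserving_comp_perm ρ (Equiv.swap 0 j)).measure_preimage
      (hRm 0).nullMeasurableSet]
    congr 1
    ext b
    simp only [hR, Set.mem_ofPred_eq, Set.mem_preimage, Function.comp_apply,
      Equiv.swap_apply_left]
    exact ⟨fun h k => h _, fun h k => by simpa using h (Equiv.swap 0 j k)⟩
  have hR0 : Measure.pi (fun _ : Fin N => ρ) (R 0) ≠ 0 := by
    intro h0
    have hcover : (Set.univ : Set (Fin N → ℝ)) ⊆ ⋃ j, R j := fun b _ => by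
      obtain ⟨j, hj⟩ := exists_eq_maxPos b
      exact Set.mem_iUnion.2 ⟨j, fun k => hj ▸ le_maxPos b k⟩
    have := measure_mono_null hcover
      (measure_iUnion_null fun j => (hRj j).trans h0 : Measure.pi (fun _ : Fin N => ρ) _ = 0)
    simp at this
  have e : renewalSet N = Set.univ.pi fun _ => R 0 := by
    ext a
    simp [renewalSet, hR]
  rw [e, noiseLaw, Measure.pi_pi]
  exact Finset.prod_ne_zero_iff.2 fun _ _ => hR0

lemma edgeSpace_nonpos (y : EdgeSpace N) (i : Fin N) : (y : Fin N → ℝ) i ≤ 0 :=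
  y.2.2 ▸ y.2.1 (Fin.zero_le i)

lemma maxPos_edgeSpace (y : EdgeSpace N) : maxPos (y : Fin N → ℝ) = 0 :=
  le_antisymm (maxPos_le (edgeSpace_nonpos y)) (y.2.2.symm.trans_le (le_maxPos _ 0))

/-- The leader sits at `0` and the others behind it, so all maxima are attained by descent from the
leader and the new positions are `a i 0`. -/
lemma edgeStep_eq_of_mem_renewalSet {a : Fin N → Fin N → ℝ} (ha : a ∈ renewalSet N)
    (y y' : EdgeSpace N) : edgeStep a y = edgeStep a y' := by
  have h (y : EdgeSpace N) : maxPlus a y = fun i => a i 0 := by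
    ext i
    refine le_antisymm (maxPos_le fun j => ?_) ?_
    · linarith [edgeSpace_nonpos y j, ha i j]
    · have := le_maxPlus a y i 0
      rwa [y.2.2, zero_add] at this
  simp only [edgeStep, h]

instance nonempty_edgeSpace : Nonempty (EdgeSpace N) := ⟨⟨0, fun _ _ _ => le_rfl, rfl⟩⟩

variable (N) in
/-- The part of the transition kernel in which no renewal takes place. -/
noncomputable def nonRenewalKernel : Kernel (EdgeSpace N) (EdgeSpace N) where
  toFun y := ((noiseLaw N ρ).restrict (renewalSet N)ᶜ).map fun a => edgeStep a y
  measurable' := by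
    refine Measure.measurable_of_measurable_coe _ fun s hs => ?_
    have h : ∀ y : EdgeSpace N,
        (((noiseLaw N ρ).restrict (renewalSet N)ᶜ).map (fun a => edgeStep a y)) s =
        (noiseLaw N ρ).restrict (renewalSet N)ᶜ ((fun a => (a, y)) ⁻¹'
          ((fun p : (Fin N → Fin N → ℝ) × EdgeSpace N => edgeStep p.1 p.2) ⁻¹' s)) := fun y =>
      Measure.map_apply (measurable_edgeStep_left y) hs
    simp_rw [h]
    exact measurable_measure_prodMk_right (measurable_edgeStep hs)

lemma edgeKernel_eq_add (y₀ y : EdgeSpace N) : edgeKernel N ρ y =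
    ((noiseLaw N ρ).restrict (renewalSet N)).map (fun a => edgeStep a y₀) +
      nonRenewalKernel N ρ y := by
  have hm (y : EdgeSpace N) := measurable_edgeStep_left y
  have h1 : ((noiseLaw N ρ).restrict (renewalSet N)).map (fun a => edgeStep a y₀) =
      ((noiseLaw N ρ).restrict (renewalSet N)).map fun a => edgeStep a y := by
    refine Measure.map_congr ?_
    filter_upwards [ae_restrict_mem measurableSet_renewalSet] with a ha
    exact edgeStep_eq_of_mem_renewalSet ha y₀ y
  rw [h1]
  change (noiseLaw N ρ).map _ = _ + ((noiseLaw N ρ).restrict (renewalSet N)ᶜ).map _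
  rw [← Measure.map_add _ _ (hm y), Measure.restrict_add_restrict_compl measurableSet_renewalSet]

lemma existsUnique_invariantLaw : ∃ ν : Measure (EdgeSpace N), IsInvariantLaw N ρ ν ∧
    ∀ ν', IsInvariantLaw N ρ ν' → ν' = ν := by
  obtain ⟨y₀⟩ := nonempty_edgeSpace (N := N)
  refine existsUnique_invariant_of_minorization ?_ (edgeKernel_eq_add ρ y₀)
  rw [Ne, ← Measure.measure_univ_eq_zero, Measure.map_apply (measurable_edgeStep_left y₀) .univ]
  simpa using noiseLaw_renewalSet_ne_zero ρ

end InvariantLaw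

/-! ### The mean front and its value in the stationary regime. -/

section MeanFront

variable {N : ℕ} [NeZero N]

/-- The mean leading position after `n` steps as a function of the initial positions, for i.i.d.
noises of law `μ`. -/
noncomputable def meanFront (μ : Measure (Fin N → Fin N → ℝ)) : ℕ → (Fin N → ℝ) → ℝ
  | 0, x => maxPos x
  | n + 1, x => ∫ a, meanFront μ n (maxPlus a x) ∂μ

section

variable {μ : Measure (Fin N → Fin N → ℝ)} [IsProbabilityMeasure μ]

lemma measurable_meanFront (n : ℕ) : Measurable (meanFront μ n) := by
  induction n with
  | zero => exact measurable_maxPos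
  | succ n ih =>
    have h : StronglyMeasurable (Function.uncurry fun (x : Fin N → ℝ) (a : Fin N → Fin N → ℝ) =>
        meanFront μ n (maxPlus a x)) :=
      (ih.comp (measurable_maxPlus.comp measurable_swap)).stronglyMeasurable
    exact h.integral_prod_right.measurable

lemma measurable_maxPlus_left (x : Fin N → ℝ) :
    Measurable fun a : Fin N → Fin N → ℝ => maxPlus a x := by
  have h := (measurable_maxPlus (N := N)).comp (measurable_prodMk_right (y := x))
  exact h

/-- The bound is a hypothesis because integrability is needed inside the induction that proves it.
-/
lemma integrable_meanFront_of_bound (hμ : Integrable (fun a => ‖a‖) μ) {n : ℕ} {K : ℝ}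
    (h : ∀ x, |meanFront μ n x - maxPos x| ≤ K) (x : Fin N → ℝ) :
    Integrable (fun a => meanFront μ n (maxPlus a x)) μ := by
  refine ((hμ.add (integrable_const (|maxPos x| + K)))).mono'
    ((measurable_meanFront n).comp (measurable_maxPlus_left x)).aestronglyMeasurable
    (.of_forall fun a => ?_)
  have h1 := h (maxPlus a x)
  have h2 := abs_maxPos_maxPlus_sub_le a x
  simp only [Real.norm_eq_abs, Pi.add_apply]
  rw [abs_le] at h1 h2 ⊢
  have := neg_abs_le (maxPos x)
  have := le_abs_self (maxPos x)
  constructor <;> linarith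

lemma abs_meanFront_sub_le (hμ : Integrable (fun a => ‖a‖) μ) (n : ℕ) (x : Fin N → ℝ) :
    |meanFront μ n x - maxPos x| ≤ n * ∫ a, ‖a‖ ∂μ := by
  induction n generalizing x with
  | zero => simp [meanFront]
  | succ n ih =>
    have hi := integrable_meanFront_of_bound hμ ih x
    have e : meanFront μ (n + 1) x - maxPos x =
        ∫ a, (meanFront μ n (maxPlus a x) - maxPos x) ∂μ := by
      rw [integral_sub hi (integrable_const _), integral_const, probReal_univ, one_smul]
      rfl
    rw [e]
    have hb : Integrable (fun a => n * ∫ a, ‖a‖ ∂μ + ‖a‖) μ := (integrable_const _).add hμ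
    refine (norm_integral_le_of_norm_le (f := fun a => meanFront μ n (maxPlus a x) - maxPos x) hb
      (.of_forall fun a => ?_)).trans_eq ?_
    · have h1 := ih (maxPlus a x)
      have h2 := abs_maxPos_maxPlus_sub_le a x
      exact (abs_sub_le _ (maxPos (maxPlus a x)) _).trans (add_le_add h1 h2)
    · rw [integral_add (integrable_const _) hμ, integral_const, probReal_univ, one_smul]
      push_cast
      ring

lemma integrable_meanFront (hμ : Integrable (fun a => ‖a‖) μ) (n : ℕ) (x : Fin N → ℝ) :
    Integrable (fun a => meanFront μ n (maxPlus a x)) μ :=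
  integrable_meanFront_of_bound hμ (abs_meanFront_sub_le hμ n) x

lemma meanFront_add_const (hμ : Integrable (fun a => ‖a‖) μ) (n : ℕ) (x : Fin N → ℝ) (c : ℝ) :
    meanFront μ n (fun i => x i + c) = meanFront μ n x + c := by
  induction n generalizing x with
  | zero => exact maxPos_add_const x c
  | succ n ih =>
    simp only [meanFront, maxPlus_add_const, ih]
    rw [integral_add (integrable_meanFront hμ n x) (integrable_const c), integral_const,
      probReal_univ, one_smul]

lemma meanFront_mono (hμ : Integrable (fun a => ‖a‖) μ) (n : ℕ) {x y : Fin N → ℝ}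
    (h : ∀ i, x i ≤ y i) : meanFront μ n x ≤ meanFront μ n y := by
  induction n generalizing x y with
  | zero => exact maxPos_mono h
  | succ n ih =>
    exact integral_mono (integrable_meanFront hμ n x) (integrable_meanFront hμ n y) fun a =>
      ih (maxPlus_mono (fun _ _ => le_rfl) h)

/-- Averaged form of the restart estimate. It is uniform over `EdgeSpace N`, so no moment of the
invariant law is ever needed. -/
lemma le_meanFront_edgeSpace (hμ : Integrable (fun a => ‖a‖) μ) (n : ℕ) (y : EdgeSpace N) :
    meanFront μ n 0 - 2 * ∫ a, ‖a‖ ∂μ ≤ meanFront μ n y := by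
  cases n with
  | zero =>
    have : 0 ≤ ∫ a, ‖a‖ ∂μ := integral_nonneg fun _ => norm_nonneg _
    simp only [meanFront, maxPos_edgeSpace, maxPos_zero]
    linarith
  | succ n =>
    have h0 := integrable_meanFront hμ n 0
    simp only [meanFront]
    rw [← integral_const_mul, ← integral_sub h0 (hμ.const_mul 2)]
    refine integral_mono (h0.sub (hμ.const_mul 2)) (integrable_meanFront hμ n y) fun a => ?_
    simp only
    rw [sub_eq_add_neg, ← meanFront_add_const hμ]
    refine meanFront_mono hμ n fun i => ?_
    have h1 := sub_norm_le_maxPlus a y i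
    have h2 := maxPlus_le a 0 i
    rw [maxPos_edgeSpace] at h1
    rw [maxPos_zero] at h2
    linarith

lemma meanFront_edgeSpace_le (hμ : Integrable (fun a => ‖a‖) μ) (n : ℕ) (y : EdgeSpace N) :
    meanFront μ n y ≤ meanFront μ n 0 := meanFront_mono hμ n (edgeSpace_nonpos y)

lemma integral_front_eq_meanFront {Ω : Type*} [MeasurableSpace Ω] {P : Measure Ω}
    [IsProbabilityMeasure P] {A : ℕ → Ω → Fin N → Fin N → ℝ} (hA : ∀ k, Measurable (A k))
    (hind : iIndepFun A P) (hlaw : ∀ k, P.map (A k) = μ) (hμ : Integrable (fun a => ‖a‖) μ)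
    (n : ℕ) : ∫ ω, front (fun k => A k ω) n ∂P = meanFront μ n 0 := by
  have hX (n : ℕ) : Measurable fun ω => flow (fun k => A k ω) 0 n :=
    (measurable_flow 0 n).comp (measurable_pi_lambda _ hA)
  have hid (k : ℕ) : IdentDistrib (A k) (A 0) P P :=
    ⟨(hA k).aemeasurable, (hA 0).aemeasurable, (hlaw k).trans (hlaw 0).symm⟩
  have hnorm : MemLp (fun ω => ‖A 0 ω‖) 1 P := by
    rw [memLp_one_iff_integrable]
    rw [← hlaw 0] at hμ
    exact hμ.comp_measurable (hA 0)
  have hF (n : ℕ) := memLp_one_iff_integrable.1 (memLp_front hA hid hnorm n)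
  have hint (k n : ℕ) : Integrable (fun ω => meanFront μ k (flow (fun k => A k ω) 0 n)) P := by
    refine ((hF n).abs.add (integrable_const (k * ∫ a, ‖a‖ ∂μ))).mono'
      ((measurable_meanFront k).comp (hX n)).aestronglyMeasurable (.of_forall fun ω => ?_)
    have h1 := abs_meanFront_sub_le hμ k (flow (fun k => A k ω) 0 n)
    have h2 := abs_sub_abs_le_abs_sub (meanFront μ k (flow (fun k => A k ω) 0 n))
      (maxPos (flow (fun k => A k ω) 0 n))
    simp only [Real.norm_eq_abs, Pi.add_apply, front]
    linarith
  -- The noise `A n` is independent of the positions at time `n`, so one step can be moved from the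
  -- random flow into `meanFront`; iterating removes the flow.
  have hstep (k n : ℕ) : ∫ ω, meanFront μ k (flow (fun k => A k ω) 0 (n + 1)) ∂P =
      ∫ ω, meanFront μ (k + 1) (flow (fun k => A k ω) 0 n) ∂P := by
    have hindep : IndepFun (fun ω => flow (fun k => A k ω) 0 n) (A n) P :=
      indepFun_prefix_suffix (n := n) (m := 1) (g := fun a => a 0) hA hind (measurable_flow 0 n)
        (measurable_pi_apply 0) (fun a b h => flow_congr h 0) (fun a b h => h 0 one_pos)
    have hmap := hindep.map_prod_eq_prod_map_map (hX n).aemeasurable (hA n).aemeasurable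
    rw [hlaw n] at hmap
    have hm : Measurable fun p : (Fin N → ℝ) × (Fin N → Fin N → ℝ) =>
        meanFront μ k (maxPlus p.2 p.1) :=
      (measurable_meanFront k).comp (measurable_maxPlus.comp measurable_swap)
    have hpair : Measurable fun ω => (flow (fun k => A k ω) 0 n, A n ω) := (hX n).prodMk (hA n)
    have hprod : Integrable (fun p : (Fin N → ℝ) × (Fin N → Fin N → ℝ) =>
        meanFront μ k (maxPlus p.2 p.1)) ((P.map fun ω => flow (fun k => A k ω) 0 n).prod μ) := by
      rw [← hmap, integrable_map_measure hm.aestronglyMeasurable hpair.aemeasurable]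
      exact hint k (n + 1)
    have h1 : ∫ ω, meanFront μ k (flow (fun k => A k ω) 0 (n + 1)) ∂P =
        ∫ p, meanFront μ k (maxPlus p.2 p.1)
          ∂((P.map fun ω => flow (fun k => A k ω) 0 n).prod μ) := by
      rw [← hmap, integral_map hpair.aemeasurable hm.aestronglyMeasurable]
      rfl
    rw [h1, integral_prod _ hprod]
    exact integral_map (hX n).aemeasurable (measurable_meanFront (k + 1)).aestronglyMeasurable
  have key (k : ℕ) : ∫ ω, meanFront μ k (flow (fun k => A k ω) 0 n) ∂P =
      meanFront μ (n + k) 0 := by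
    induction n generalizing k with
    | zero => simp [flow]
    | succ n ih => rw [hstep, ih, add_right_comm, add_assoc]
  exact key 0

end

section Stationary

variable {ρ : Measure ℝ} [IsProbabilityMeasure ρ]

lemma maxPos_comp_perm (x : Fin N → ℝ) (σ : Equiv.Perm (Fin N)) : maxPos (x ∘ σ) = maxPos x :=
  le_antisymm (maxPos_le fun i => le_maxPos x (σ i))
    (maxPos_le fun i => by simpa using le_maxPos (x ∘ σ) (σ.symm i))

lemma maxPlus_comp_perm (a : Fin N → Fin N → ℝ) (x : Fin N → ℝ) (σ : Equiv.Perm (Fin N)) :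
    maxPlus a (x ∘ σ) = maxPlus (fun i => a i ∘ σ.symm) x := by
  ext i
  rw [maxPlus_apply, maxPlus_apply,
    ← maxPos_comp_perm (fun j => x j + (a i ∘ σ.symm) j) σ]
  congr 1
  ext j
  simp

/-- The first noise matrix has exchangeable columns, which absorb a relabelling of the initial
particles. Hence ordering the particles does not affect mean fronts. -/
lemma meanFront_comp_perm (n : ℕ) (x : Fin N → ℝ) (σ : Equiv.Perm (Fin N)) :
    meanFront (noiseLaw N ρ) n (x ∘ σ) = meanFront (noiseLaw N ρ) n x := by
  cases n with
  | zero => exact maxPos_comp_perm x σ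
  | succ n =>
    have hT : MeasurePreserving (fun (a : Fin N → Fin N → ℝ) i => a i ∘ σ.symm) (noiseLaw N ρ)
        (noiseLaw N ρ) :=
      measurePreserving_pi _ _ fun _ => measurePreserving_comp_perm ρ σ.symm
    simp only [meanFront, maxPlus_comp_perm]
    have h := integral_map (μ := noiseLaw N ρ) hT.measurable.aemeasurable
      (f := fun a => meanFront (noiseLaw N ρ) n (maxPlus a x))
      ((measurable_meanFront n).comp (measurable_maxPlus_left x)).aestronglyMeasurable
    rw [hT.map_eq] at h
    exact h.symm

omit [NeZero N] in
lemma ordered_eq_comp_perm (x : Fin N → ℝ) :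
    ordered x = x ∘ (Fin.revPerm.trans (Tuple.sort x)) := rfl

lemma meanFront_shift_ordered (hρ : Integrable (fun a => ‖a‖) (noiseLaw N ρ)) (n : ℕ)
    (x : Fin N → ℝ) : meanFront (noiseLaw N ρ) n (shift (ordered x)) =
      meanFront (noiseLaw N ρ) n x - maxPos x := by
  have e : shift (ordered x) = fun i => ordered x i + -maxPos (ordered x) := rfl
  rw [e, meanFront_add_const hρ, ordered_eq_comp_perm, meanFront_comp_perm, maxPos_comp_perm,
    sub_eq_add_neg]

lemma maxJump_eq (a : Fin N → Fin N → ℝ) (y : Fin N → ℝ) : maxJump a y = maxPos (maxPlus a y) := by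
  refine le_antisymm (Finset.sup'_le _ _ fun p _ => ?_) (maxPos_le fun i => maxPos_le fun j => ?_)
  · exact (le_maxPlus a y p.1 p.2).trans (le_maxPos _ p.1)
  · exact Finset.le_sup' (fun p : Fin N × Fin N => y p.2 + a p.1 p.2) (Finset.mem_univ (i, j))

lemma measurable_maxJump_left (y : Fin N → ℝ) :
    Measurable fun a : Fin N → Fin N → ℝ => maxJump a y := by
  simp only [maxJump_eq]
  exact measurable_maxPos.comp (measurable_maxPlus_left y)

lemma abs_maxJump_le (a : Fin N → Fin N → ℝ) (y : EdgeSpace N) : |maxJump a y| ≤ ‖a‖ := by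
  have := abs_maxPos_maxPlus_sub_le a y
  rwa [maxPos_edgeSpace, sub_zero, ← maxJump_eq] at this

omit [IsProbabilityMeasure ρ] in
lemma integrable_maxJump (hρ : Integrable (fun a => ‖a‖) (noiseLaw N ρ)) (y : EdgeSpace N) :
    Integrable (fun a => maxJump a y) (noiseLaw N ρ) :=
  hρ.mono' (measurable_maxJump_left _).aestronglyMeasurable (.of_forall fun a => abs_maxJump_le a y)

lemma integrable_integral_maxJump (hρ : Integrable (fun a => ‖a‖) (noiseLaw N ρ))
    (ν : Measure (EdgeSpace N)) [IsFiniteMeasure ν] :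
    Integrable (fun y : EdgeSpace N => ∫ a, maxJump a y ∂noiseLaw N ρ) ν := by
  have hm : Measurable fun y : EdgeSpace N => ∫ a, maxJump a y ∂noiseLaw N ρ := by
    simp only [maxJump_eq]
    exact (measurable_meanFront (μ := noiseLaw N ρ) 1).comp measurable_subtype_coe
  refine (integrable_const (∫ a, ‖a‖ ∂noiseLaw N ρ)).mono' hm.aestronglyMeasurable
    (.of_forall fun y => ?_)
  exact norm_integral_le_of_norm_le hρ (.of_forall fun a => abs_maxJump_le a y)

lemma map_edgeStep_of_invariant {ν : Measure (EdgeSpace N)} (hν : IsInvariantLaw N ρ ν) :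
    ((noiseLaw N ρ).prod ν).map (fun p => edgeStep p.1 p.2) = ν := by
  have := hν.1
  refine Measure.ext fun s hs => ?_
  conv_rhs => rw [← hν.2.def]
  rw [Measure.bind_apply hs (edgeKernel N ρ).aemeasurable, Measure.map_apply measurable_edgeStep hs,
    Measure.prod_apply_symm (measurable_edgeStep hs)]
  refine lintegral_congr fun y => ?_
  change _ = (noiseLaw N ρ).map (fun a => edgeStep a y) s
  rw [Measure.map_apply (measurable_edgeStep_left y) hs]
  rfl

lemma integrable_meanFront_edgeSpace (hρ : Integrable (fun a => ‖a‖) (noiseLaw N ρ))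
    (ν : Measure (EdgeSpace N)) [IsFiniteMeasure ν] (n : ℕ) :
    Integrable (fun y : EdgeSpace N => meanFront (noiseLaw N ρ) n y) ν := by
  refine (integrable_const (|meanFront (noiseLaw N ρ) n 0| + 2 * ∫ a, ‖a‖ ∂noiseLaw N ρ)).mono'
    ((measurable_meanFront n).comp measurable_subtype_coe).aestronglyMeasurable
    (.of_forall fun y => ?_)
  have h1 := le_meanFront_edgeSpace hρ n y
  have h2 := meanFront_edgeSpace_le hρ n y
  have h3 := abs_le.1 (le_refl |meanFront (noiseLaw N ρ) n 0|)
  have h4 : 0 ≤ ∫ a, ‖a‖ ∂noiseLaw N ρ := integral_nonneg fun _ => norm_nonneg _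
  rw [Real.norm_eq_abs, abs_le]
  constructor <;> linarith

/-- In the stationary regime the front advances by the same mean amount at each step. -/
lemma integral_meanFront_eq (hρ : Integrable (fun a => ‖a‖) (noiseLaw N ρ))
    {ν : Measure (EdgeSpace N)} (hν : IsInvariantLaw N ρ ν) (n : ℕ) :
    ∫ y : EdgeSpace N, meanFront (noiseLaw N ρ) n y ∂ν =
      n * ∫ y : EdgeSpace N, ∫ a, maxJump a y ∂noiseLaw N ρ ∂ν := by
  have := hν.1
  induction n with
  | zero => simp [meanFront, maxPos_edgeSpace]
  | succ n ih =>
    have hf : Measurable fun y : EdgeSpace N => meanFront (noiseLaw N ρ) n y :=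
      (measurable_meanFront n).comp measurable_subtype_coe
    -- Ordering is invisible to `meanFront` and the shift merely subtracts the jump of the maximum;
    -- integrating against `ν` turns this into a recursion in `n`.
    have hstep (y : EdgeSpace N) :
        ∫ a, meanFront (noiseLaw N ρ) n (edgeStep a y : Fin N → ℝ) ∂noiseLaw N ρ =
          meanFront (noiseLaw N ρ) (n + 1) y - ∫ a, maxJump a y ∂noiseLaw N ρ := by
      have e (a : Fin N → Fin N → ℝ) : meanFront (noiseLaw N ρ) n (edgeStep a y : Fin N → ℝ) =
          meanFront (noiseLaw N ρ) n (maxPlus a y) - maxJump a y := by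
        rw [maxJump_eq, ← meanFront_shift_ordered hρ]
        rfl
      simp_rw [e]
      rw [integral_sub (integrable_meanFront hρ n y) (integrable_maxJump hρ y)]
      rfl
    have h1 : ∫ y : EdgeSpace N, meanFront (noiseLaw N ρ) n y ∂ν =
        ∫ y : EdgeSpace N, (meanFront (noiseLaw N ρ) (n + 1) y -
          ∫ a, maxJump a y ∂noiseLaw N ρ) ∂ν := by
      have hi := integrable_meanFront_edgeSpace hρ ν n
      conv_lhs => rw [← map_edgeStep_of_invariant hν]
      rw [integral_map measurable_edgeStep.aemeasurable hf.aestronglyMeasurable,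
        integral_prod_symm]
      · exact integral_congr_ae (.of_forall hstep)
      · rw [← map_edgeStep_of_invariant hν] at hi
        exact hi.comp_measurable measurable_edgeStep
    rw [integral_sub (integrable_meanFront_edgeSpace hρ ν (n + 1))
      (integrable_integral_maxJump hρ ν), ih] at h1
    push_cast
    linarith

/-- The speed of the front is the mean advance per step in the stationary regime. -/
lemma speed_eq_integral (hρ : Integrable (fun a => ‖a‖) (noiseLaw N ρ))
    {ν : Measure (EdgeSpace N)} (hν : IsInvariantLaw N ρ ν) {v C : ℝ}
    (hv : ∀ n : ℕ, |meanFront (noiseLaw N ρ) n 0 - v * n| ≤ C) :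
    v = ∫ y : EdgeSpace N, ∫ a, maxJump a y ∂noiseLaw N ρ ∂ν := by
  have := hν.1
  set g := ∫ y : EdgeSpace N, ∫ a, maxJump a y ∂noiseLaw N ρ ∂ν with hg
  set c := ∫ a, ‖a‖ ∂noiseLaw N ρ with hc
  -- Both `g * n` and `v * n` are within a bounded distance of the mean front from the origin,
  -- uniformly in `n`.
  have hbound (n : ℕ) : |(g - v) * n| ≤ 2 * c + C := by
    have hi := integrable_meanFront_edgeSpace hρ ν n
    have h1 := integral_meanFront_eq hρ hν n
    have h2 : ∫ y : EdgeSpace N, meanFront (noiseLaw N ρ) n y ∂ν ≤ meanFront (noiseLaw N ρ) n 0 := by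
      have := integral_mono hi (integrable_const (meanFront (noiseLaw N ρ) n 0))
        (meanFront_edgeSpace_le hρ n)
      rwa [integral_const, probReal_univ, one_smul] at this
    have h3 : meanFront (noiseLaw N ρ) n 0 - 2 * c ≤
        ∫ y : EdgeSpace N, meanFront (noiseLaw N ρ) n y ∂ν := by
      have := integral_mono (integrable_const (meanFront (noiseLaw N ρ) n 0 - 2 * c)) hi
        (le_meanFront_edgeSpace hρ n)
      rwa [integral_const, probReal_univ, one_smul] at this
    have h4 := abs_le.1 (hv n)
    have h5 : 0 ≤ c := integral_nonneg fun _ => norm_nonneg _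
    rw [abs_le]
    constructor <;> linarith [h4.1, h4.2]
  by_contra hne
  have hpos : 0 < |g - v| := abs_pos.2 (sub_ne_zero.2 (Ne.symm hne))
  obtain ⟨n, hn⟩ := exists_nat_gt ((2 * c + C) / |g - v|)
  have h := hbound n
  rw [abs_mul, Nat.abs_cast] at h
  rw [div_lt_iff₀ hpos] at hn
  linarith

end Stationary

end MeanFront

/-! ### From the array `ξ` to i.i.d. noise matrices. -/

section Noise

variable {N : ℕ} {ρ : Measure ℝ} [IsProbabilityMeasure ρ]

lemma memLp_norm_noiseLaw {p : ENNReal} (h : MemLp id p ρ) :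
    MemLp (fun a : Fin N → Fin N → ℝ => ‖a‖) p (noiseLaw N ρ) := by
  have h1 : MemLp (fun a : Fin N → Fin N → ℝ => a) p (noiseLaw N ρ) := by
    refine MemLp.of_eval fun i => MemLp.of_eval fun j => ?_
    exact (h.comp_measurePreserving (measurePreserving_eval (fun _ : Fin N => ρ) j)
      ).comp_measurePreserving (measurePreserving_eval
        (fun _ : Fin N => Measure.pi fun _ : Fin N => ρ) i)
  exact h1.norm

lemma noiseLaw_forall_ne_zero {s : Set ℝ} (h : ρ s ≠ 0) :
    noiseLaw N ρ {a | ∀ i j, a i j ∈ s} ≠ 0 := by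
  have e : {a : Fin N → Fin N → ℝ | ∀ i j, a i j ∈ s} =
      Set.univ.pi fun _ => Set.univ.pi fun _ => s := by
    ext a
    simp
  rw [e, noiseLaw, Measure.pi_pi]
  refine Finset.prod_ne_zero_iff.2 fun _ _ => ?_
  rw [Measure.pi_pi]
  exact Finset.prod_ne_zero_iff.2 fun _ _ => h

/-- A law that is not a Dirac mass charges two separated half-lines. -/
lemma exists_separated_of_ne_dirac (hint : Integrable id ρ) (h : ∀ c : ℝ, ρ ≠ Measure.dirac c) :
    ∃ c₁ c₂ : ℝ, c₁ < c₂ ∧ ρ (Set.Iic c₁) ≠ 0 ∧ ρ (Set.Ici c₂) ≠ 0 := by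
  set m := ∫ x, id x ∂ρ with hm
  -- Both closed half-lines at the mean have mass. If neither can be replaced by a strictly smaller
  -- one, all the mass sits at the mean.
  have hle : ρ (Set.Iic m) ≠ 0 := (measure_le_integral_pos hint).ne'
  have hge : ρ (Set.Ici m) ≠ 0 := (measure_integral_le_pos hint).ne'
  by_cases h1 : ∃ c < m, ρ (Set.Iic c) ≠ 0
  · obtain ⟨c, hc, hc0⟩ := h1
    exact ⟨c, m, hc, hc0, hge⟩
  by_cases h2 : ∃ c > m, ρ (Set.Ici c) ≠ 0
  · obtain ⟨c, hc, hc0⟩ := h2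
    exact ⟨m, c, hc, hle, hc0⟩
  push Not at h1 h2
  exfalso
  have hpos (n : ℕ) : (0 : ℝ) < 1 / (n + 1) := by positivity
  have hae : ∀ᵐ x ∂ρ, id x = m := by
    have ha : ∀ᵐ x ∂ρ, ∀ n : ℕ, m - 1 / (n + 1) < x :=
      ae_all_iff.2 fun n => by
        have := h1 (m - 1 / (n + 1)) (by linarith [hpos n])
        rw [measure_eq_zero_iff_ae_notMem] at this
        exact this.mono fun x hx => not_le.1 hx
    have hb : ∀ᵐ x ∂ρ, ∀ n : ℕ, x < m + 1 / (n + 1) :=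
      ae_all_iff.2 fun n => by
        have := h2 (m + 1 / (n + 1)) (by linarith [hpos n])
        rw [measure_eq_zero_iff_ae_notMem] at this
        exact this.mono fun x hx => not_le.1 hx
    filter_upwards [ha, hb] with x hxa hxb
    have ht : Tendsto (fun n : ℕ => 1 / ((n : ℝ) + 1)) atTop (𝓝 0) :=
      tendsto_one_div_add_atTop_nhds_zero_nat
    refine le_antisymm ?_ ?_
    · have := ge_of_tendsto' (ht.const_add m) fun n => (hxb n).le
      simpa using this
    · have := le_of_tendsto' (ht.const_sub m) fun n => (hxa n).le
      simpa using this
  have hmap : ρ.map id = Measure.dirac m := (hasLaw_dirac_of_ae_eq hae).map_eq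
  rw [Measure.map_id] at hmap
  exact h m hmap

variable {Ω : Type*} [MeasurableSpace Ω] {P : Measure Ω}

/-- The noise matrices of the particle system are i.i.d. with law `noiseLaw N ρ`, up to a null
set. -/
lemma exists_noise_sequence {ξ : ℕ → Fin N → Fin N → Ω → ℝ}
    (hlaw : ∀ s, 1 ≤ s → ∀ i j, HasLaw (ξ s i j) ρ P)
    (hindep : iIndepFun (fun p : ℕ × Fin N × Fin N => ξ (p.1 + 1) p.2.1 p.2.2) P) :
    ∃ A : ℕ → Ω → Fin N → Fin N → ℝ, (∀ k, Measurable (A k)) ∧ iIndepFun A P ∧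
      (∀ k, P.map (A k) = noiseLaw N ρ) ∧
      ∀ᵐ ω ∂P, (fun s i j => ξ (s + 1) i j ω) = fun s => A s ω := by
  have := hindep.isProbabilityMeasure
  have hl (p : ℕ × Fin N × Fin N) : HasLaw (ξ (p.1 + 1) p.2.1 p.2.2) ρ P :=
    hlaw (p.1 + 1) (Nat.le_add_left _ _) p.2.1 p.2.2
  -- Measurable versions are chosen entry by entry; the index set is countable, so the exceptional
  -- sets have null union.
  set X : ℕ × Fin N × Fin N → Ω → ℝ := fun p => (hl p).aemeasurable.mk _ with hX
  have hXm (p : ℕ × Fin N × Fin N) : Measurable (X p) := (hl p).aemeasurable.measurable_mk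
  have hXae (p : ℕ × Fin N × Fin N) : ξ (p.1 + 1) p.2.1 p.2.2 =ᵐ[P] X p :=
    (hl p).aemeasurable.ae_eq_mk
  have hXi : iIndepFun X P := hindep.congr hXae
  have hXlaw (p : ℕ × Fin N × Fin N) : P.map (X p) = ρ :=
    (Measure.map_congr (hXae p)).symm.trans (hl p).map_eq
  refine ⟨fun s ω i j => X (s, i, j) ω,
    fun s => measurable_pi_lambda _ fun i => measurable_pi_lambda _ fun j => hXm _, ?_, ?_, ?_⟩
  · exact (iIndepFun_curry hXm hXi).comp (fun _ b i j => b (i, j)) fun _ =>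
      measurable_pi_lambda _ fun i => measurable_pi_lambda _ fun j => measurable_pi_apply _
  · intro s
    have h1 : iIndepFun (fun q : Fin N × Fin N => X (s, q)) P :=
      hXi.precomp (g := fun q => (s, q)) fun _ _ h => (Prod.mk.inj h).2
    have h2 := iIndepFun_curry (fun q => hXm (s, q)) h1
    have h3 (i : Fin N) : P.map (fun ω j => X (s, i, j) ω) = Measure.pi fun _ => ρ := by
      have := (h1.precomp (g := fun j : Fin N => (i, j)) fun _ _ h =>
        (Prod.mk.inj h).2).map_fun_eq_infinitePi_map fun j => hXm _
      rw [this]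
      simp_rw [hXlaw]
      rw [Measure.infinitePi_eq_pi]
    refine (h2.map_fun_eq_infinitePi_map fun i => measurable_pi_lambda _ fun j => hXm _).trans ?_
    refine (congrArg Measure.infinitePi (funext h3)).trans ?_
    exact Measure.infinitePi_eq_pi _
  · have : ∀ᵐ ω ∂P, ∀ p : ℕ × Fin N × Fin N, ξ (p.1 + 1) p.2.1 p.2.2 ω = X p ω :=
      ae_all_iff.2 hXae
    filter_upwards [this] with ω hω
    ext s i j
    exact hω (s, i, j)

lemma aemeasurable_particles [NeZero N] {ξ : ℕ → Fin N → Fin N → Ω → ℝ} {X₀ : Fin N → Ω → ℝ}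
    (hξ : ∀ s, 1 ≤ s → ∀ i j, AEMeasurable (ξ s i j) P) (hX₀ : ∀ i, AEMeasurable (X₀ i) P)
    (t : ℕ) : AEMeasurable (fun ω => particles ξ X₀ t ω) P := by
  induction t with
  | zero => exact aemeasurable_pi_lambda _ hX₀
  | succ t ih =>
    have h1 : AEMeasurable (fun ω i j => ξ (t + 1) i j ω) P :=
      aemeasurable_pi_lambda _ fun i => aemeasurable_pi_lambda _ fun j =>
        hξ _ (Nat.le_add_left _ _) i j
    exact measurable_maxPlus.comp_aemeasurable (h1.prodMk ih)

end Noise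

/-! ### Passing from the front to arbitrary initial positions. -/

section ArbitraryStart

variable {N : ℕ} [NeZero N]

lemma tendsto_maxPos_minPos_flow_div {a : ℕ → Fin N → Fin N → ℝ} {v : ℝ}
    (hfront : Tendsto (fun t : ℕ => front a t / t) atTop (𝓝 v))
    (ha : Tendsto (fun t : ℕ => ‖a t‖ / t) atTop (𝓝 0)) (x : Fin N → ℝ) :
    Tendsto (fun t : ℕ => (t : ℝ)⁻¹ * maxPos (flow a x t)) atTop (𝓝 v) ∧
      Tendsto (fun t : ℕ => (t : ℝ)⁻¹ * minPos (flow a x t)) atTop (𝓝 v) := by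
  have hmax : Tendsto (fun t : ℕ => (t : ℝ)⁻¹ * maxPos (flow a x t)) atTop (𝓝 v) := by
    have h0 : Tendsto (fun t : ℕ => (t : ℝ)⁻¹ * (maxPos (flow a x t) - front a t)) atTop (𝓝 0) := by
      refine squeeze_zero_norm (fun t => ?_) (tendsto_const_div_atTop_nhds_zero_nat ‖x‖)
      rw [norm_mul, norm_inv, Real.norm_natCast, div_eq_inv_mul]
      gcongr
      exact abs_maxPos_flow_sub_front_le a x t
    have h1 := hfront.add h0
    rw [add_zero] at h1
    refine h1.congr fun t => ?_
    ring
  refine ⟨hmax, ?_⟩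
  have h0 : Tendsto (fun t : ℕ => (t : ℝ)⁻¹ * (minPos (flow a x t) - maxPos (flow a x t))) atTop
      (𝓝 0) := by
    -- The spread at time `t + 1` is controlled by the noise `a t`.
    rw [← tendsto_add_atTop_iff_nat 1]
    have h2 : Tendsto (fun t : ℕ => 2 * (‖a t‖ / t)) atTop (𝓝 0) := by
      simpa using ha.const_mul 2
    refine squeeze_zero_norm' ((eventually_ge_atTop 1).mono fun t ht => ?_) h2
    have ht0 : (0 : ℝ) < t := by exact_mod_cast ht
    rw [norm_mul, norm_inv, Real.norm_natCast, ← mul_div_assoc, div_eq_inv_mul]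
    have h3 := maxPos_sub_minPos_flow_le a x t
    have h4 := minPos_le_maxPos (flow a x (t + 1))
    gcongr
    · exact Nat.le_succ t
    · rw [Real.norm_eq_abs, abs_le]
      constructor <;> linarith [norm_nonneg (a t)]
  have h1 := hmax.add h0
  rw [add_zero] at h1
  refine h1.congr fun t => ?_
  ring

end ArbitraryStart

end BrunetDerrida

/-! ### Assembly of the theorem. -/

open BrunetDerrida in
theorem corollary2p1 {N : ℕ} [NeZero N] {Ω : Type*} [MeasurableSpace Ω]
    (P : Measure Ω) [IsProbabilityMeasure P]
    (ρ : Measure ℝ) [IsProbabilityMeasure ρ]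
    (ξ : ℕ → Fin N → Fin N → Ω → ℝ)
    (hlaw : ∀ s, 1 ≤ s → ∀ i j, HasLaw (ξ s i j) ρ P)
    (hindep : iIndepFun (fun p : ℕ × Fin N × Fin N => ξ (p.1 + 1) p.2.1 p.2.2) P) :
    ∃ ν : Measure (BrunetDerrida.EdgeSpace N),
      BrunetDerrida.IsInvariantLaw N ρ ν ∧
      (∀ ν', BrunetDerrida.IsInvariantLaw N ρ ν' → ν' = ν) ∧
      (MemLp id 1 ρ →
        ∃ v : ℝ,
          -- the formula for the speed, with the integrability that it presupposes
          (∀ y : BrunetDerrida.EdgeSpace N,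
            Integrable (fun ω => BrunetDerrida.maxJump (fun i j => ξ 1 i j ω) y) P) ∧
          Integrable (fun y : BrunetDerrida.EdgeSpace N =>
            ∫ ω, BrunetDerrida.maxJump (fun i j => ξ 1 i j ω) y ∂P) ν ∧
          v = ∫ y : BrunetDerrida.EdgeSpace N,
            (∫ ω, BrunetDerrida.maxJump (fun i j => ξ 1 i j ω) y ∂P) ∂ν ∧
          -- law of large numbers
          (∀ X₀ : Fin N → Ω → ℝ, (∀ i, AEMeasurable (X₀ i) P) → ∀ᵐ ω ∂P,
            Tendsto (fun t : ℕ =>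
              (t : ℝ)⁻¹ * BrunetDerrida.maxPos (BrunetDerrida.particles ξ X₀ t ω)) atTop (𝓝 v) ∧
            Tendsto (fun t : ℕ =>
              (t : ℝ)⁻¹ * BrunetDerrida.minPos (BrunetDerrida.particles ξ X₀ t ω)) atTop (𝓝 v)) ∧
          -- central limit theorem
          (MemLp id 2 ρ → (∀ c : ℝ, ρ ≠ Measure.dirac c) →
            ∃ σ2 : ℝ≥0, 0 < σ2 ∧
              ∀ X₀ : Fin N → Ω → ℝ, (∀ i, AEMeasurable (X₀ i) P) →
                TendstoInDistribution
                  (fun (t : ℕ) ω => (Real.sqrt t)⁻¹ *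
                    (BrunetDerrida.maxPos (BrunetDerrida.particles ξ X₀ t ω) - v * t))
                  atTop (id : ℝ → ℝ) (fun _ => P) (gaussianReal 0 σ2))) := by
  obtain ⟨A, hA, hind, hAlaw, hae⟩ := exists_noise_sequence hlaw hindep
  have hid (k : ℕ) : IdentDistrib (A k) (A 0) P P :=
    ⟨(hA k).aemeasurable, (hA 0).aemeasurable, (hAlaw k).trans (hAlaw 0).symm⟩
  -- The null set comes from the noise alone, so it serves all initial positions at once.
  have hparticles : ∀ᵐ ω ∂P, ∀ (X₀ : Fin N → Ω → ℝ) (t : ℕ),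
      particles ξ X₀ t ω = flow (fun k => A k ω) (fun i => X₀ i ω) t := by
    filter_upwards [hae] with ω hω X₀ t
    rw [particles_eq_flow, hω]
  have hnoise : ∀ᵐ ω ∂P, (fun i j => ξ 1 i j ω) = A 0 ω :=
    hae.mono fun ω hω => congrFun hω 0
  obtain ⟨ν, hν, hunique⟩ := existsUnique_invariantLaw (N := N) ρ
  have := hν.1
  refine ⟨ν, hν, hunique, fun h1 => ?_⟩
  have hρ : Integrable (fun a : Fin N → Fin N → ℝ => ‖a‖) (noiseLaw N ρ) :=
    memLp_one_iff_integrable.1 (memLp_norm_noiseLaw h1)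
  have hA1 : Integrable (fun ω => ‖A 0 ω‖) P := by
    have := hρ
    rw [← hAlaw 0] at this
    exact this.comp_measurable (hA 0)
  obtain ⟨v, hv⟩ := exists_speed hA hind hid hA1
  have hmaxJump (y : EdgeSpace N) :
      (fun ω => maxJump (fun i j => ξ 1 i j ω) (y : Fin N → ℝ)) =ᵐ[P] fun ω => maxJump (A 0 ω) y :=
    hnoise.mono fun ω hω => by simp only [hω]
  have hexp (y : EdgeSpace N) : ∫ ω, maxJump (fun i j => ξ 1 i j ω) (y : Fin N → ℝ) ∂P =
      ∫ a, maxJump a y ∂noiseLaw N ρ := by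
    rw [integral_congr_ae (hmaxJump y), ← hAlaw 0, integral_map (hA 0).aemeasurable
      (measurable_maxJump_left _).aestronglyMeasurable]
  refine ⟨v, fun y => ?_, ?_, ?_, fun X₀ hX₀ => ?_, fun h2 hne => ?_⟩
  · rw [integrable_congr (hmaxJump y)]
    have := integrable_maxJump hρ y
    rw [← hAlaw 0] at this
    exact this.comp_measurable (hA 0)
  · simp_rw [hexp]
    exact integrable_integral_maxJump hρ ν
  · simp_rw [hexp]
    refine speed_eq_integral hρ hν (C := 2 * ∫ ω, ‖A 0 ω‖ ∂P) fun n => ?_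
    rw [← integral_front_eq_meanFront hA hind hAlaw hρ n]
    exact hv n
  · filter_upwards [hparticles, ae_tendsto_front_div hA hind hid hA1 hv,
      ae_tendsto_norm_div hind hid hA1] with ω hω h3 h4
    simp_rw [hω]
    exact tendsto_maxPos_minPos_flow_div h3 h4 _
  · have hA2 : MemLp (fun ω => ‖A 0 ω‖) 2 P := by
      have := memLp_norm_noiseLaw (N := N) h2
      rw [← hAlaw 0] at this
      exact this.comp_of_map (hA 0).aemeasurable
    obtain ⟨σ, hσ⟩ := exists_diffusivity hA hind hid hA2
    obtain ⟨c₁, c₂, hc, hc₁, hc₂⟩ :=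
      exists_separated_of_ne_dirac (memLp_one_iff_integrable.1 h1) hne
    have hpos (s : Set ℝ) (hs : MeasurableSet s) (h : ρ s ≠ 0) :
        P {ω | ∀ i j, A 0 ω i j ∈ s} ≠ 0 := by
      have hm : MeasurableSet {a : Fin N → Fin N → ℝ | ∀ i j, a i j ∈ s} := by
        simp only [Set.ofPred_forall]
        exact .iInter fun i => .iInter fun j =>
          ((measurable_pi_apply j).comp (measurable_pi_apply i)) hs
      have := noiseLaw_forall_ne_zero (N := N) h
      rwa [← hAlaw 0, Measure.map_apply (hA 0) hm] at this
    have hσ0 := diffusivity_ne_zero hA hind hid hA2 hc (hpos _ measurableSet_Iic hc₁)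
      (hpos _ measurableSet_Ici hc₂) hσ
    refine ⟨(σ ^ 2).toNNReal, Real.toNNReal_pos.2 (by positivity), fun X₀ hX₀ => ?_⟩
    -- Slutsky: replacing the start by the origin changes the maximum by at most the norm of the
    -- start, which is negligible after division by `√t`.
    refine tendstoInDistribution_of_tendstoInMeasure_sub _ _
      (tendstoInDistribution_front hA hind hid hA2 hv hσ) ?_ fun t => ?_
    · refine tendstoInMeasure_of_tendsto_ae (fun t => ?_) ?_
      · refine AEMeasurable.aestronglyMeasurable ?_
        have hF : AEMeasurable (fun ω => front (fun k => A k ω) t) P :=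
          ((measurable_front t).comp (measurable_pi_lambda _ hA)).aemeasurable
        exact (((measurable_maxPos.comp_aemeasurable (aemeasurable_particles
          (fun s hs i j => (hlaw s hs i j).aemeasurable) hX₀ t)).sub_const _).const_mul _).sub
            ((hF.sub_const _).const_mul _)
      · filter_upwards [hparticles] with ω hω
        have hsqrt : Tendsto (fun t : ℕ => ‖fun i => X₀ i ω‖ / √t) atTop (𝓝 0) :=
          (Real.tendsto_sqrt_atTop.comp tendsto_natCast_atTop_atTop).const_div_atTop _
        refine squeeze_zero_norm (fun t => ?_) hsqrt
        simp only [Pi.sub_apply, hω]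
        rw [← mul_sub, sub_sub_sub_cancel_right, norm_mul, norm_inv,
          Real.norm_of_nonneg (Real.sqrt_nonneg _), div_eq_inv_mul]
        gcongr
        exact abs_maxPos_flow_sub_front_le _ _ t
    · exact ((measurable_maxPos.comp_aemeasurable (aemeasurable_particles
        (fun s hs i j => (hlaw s hs i j).aemeasurable) hX₀ t)).sub_const _).const_mul _
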